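/- Let $\mathfrak E$ be an elliptic curve over the finite field $\mathbb F_q$, given by a nonsingular Weierstrass equation, and let $E=\mathbb F_q(\mathfrak E)=\mathbb F_q(x,y)$ be its function field. Let $O$ be the infinite place of $E$ (the common pole of $x$ and $y$). Let $\mathrm{Aut}(E/\mathbb F_q)$ be the group of field automorphisms of $E$ fixing $\mathbb F_q$ elementwise, and let $\mathrm{Aut}(E,O)=\{\sigma\in\mathrm{Aut}(E/\mathbb F_q):\sigma(O)=O\}$. Let $T_E=\{\tau_Q : Q\in\mathfrak E(\mathbb F_q)\}$ be the translation group, where $\tau_Q\in\mathrm{Aut}(E/\mathbb F_q)$ is the automorphism induced by $P\mapsto P\oplus Q$, i.e. $(\tau_Q f)(P)=f(P\ominus Q)$. Every $\sigma\in\mathrm{Aut}(E/\mathbb F_q)$ can be written uniquely as $\sigma=\tau\rho$ with $\tau\in T_E$ and $\rho\in\mathrm{Aut}(E,O)$, and $\pi(\sigma)=\rho$ defines a group homomorphism $\pi:\mathrm{Aut}(E/\mathbb F_q)\to\mathrm{Aut}(E,O)$. For every subgroup $G$ of $\mathrm{Aut}(E/\mathbb F_q)$, the group $\pi(G)$ acts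 on $T_E\cap G$ by conjugation, $\tau\mapsto\rho\tau\rho^{-1}$, and for this action $$G\;\cong\;(T_E\cap G)\rtimes\pi(G).$$ More precisely, the isomorphism can be chosen compatible with the exact sequence $1\to T_E\cap G\to G\xrightarrow{\ \pi\ }\pi(G)\to 1$: it is the identity on $T_E\cap G$ and turns $\pi|_G$ into the projection onto the second factor. -/

import Mathlib

open scoped Polynomial nonZeroDivisors Pointwise WithZero

noncomputable section

namespace EllipticFunctionField

open WeierstrassCurve WeierstrassCurve.Affine Polynomial

variable {F : Type*} [Field F] (W : WeierstrassCurve F)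

/-- The function field `E = F(x, y)` of a Weierstrass curve `W` over `F`, where `x` and `y` satisfy
the Weierstrass equation of `W`. -/
abbrev FunField : Type _ := W.toAffine.FunctionField

/-- The group `Aut(E/F)` of field automorphisms of `E` that fix every element of `F`; the product
is composition. -/
abbrev Aut : Type _ := FunField W ≃ₐ[F] FunField W

/-! ### The infinite place -/

/-- The order of the pole of a function `f ≠ 0` in `F[x, y]` at the point at infinity, namely the
degree in `x` of its norm to `F[x]`. If `f = p + q y` with `p, q` in `F[x]`, then it is
`max (2 deg p) (2 deg q + 3)`, so that `x` has a pole of order `2` and `y` one of order `3`. -/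
def poleOrder (f : W.toAffine.CoordinateRing) : ℕ := (Algebra.norm F[X] f).natDegree

lemma norm_ne_zero {f : W.toAffine.CoordinateRing} (hf : f ≠ 0) : Algebra.norm F[X] f ≠ 0 :=
  haveI : Module.Finite F[X] W.toAffine.CoordinateRing := .of_basis (CoordinateRing.basis W.toAffine)
  fun h ↦ hf <| Algebra.norm_eq_zero_iff.mp h

lemma poleOrder_mul {f g : W.toAffine.CoordinateRing} (hf : f ≠ 0) (hg : g ≠ 0) :
    poleOrder W (f * g) = poleOrder W f + poleOrder W g := by
  rw [poleOrder, map_mul, natDegree_mul (norm_ne_zero W hf) (norm_ne_zero W hg)]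
  rfl

lemma degree_norm_add_le (f g : W.toAffine.CoordinateRing) :
    (Algebra.norm F[X] (f + g)).degree ≤
      max (Algebra.norm F[X] f).degree (Algebra.norm F[X] g).degree := by
  obtain ⟨p, q, rfl⟩ := CoordinateRing.exists_smul_basis_eq f
  obtain ⟨r, s, rfl⟩ := CoordinateRing.exists_smul_basis_eq g
  rw [add_add_add_comm, ← add_smul, ← add_smul]
  simp only [CoordinateRing.degree_norm_smul_basis]
  have h1 := degree_add_le p r
  have h2 := degree_add_le q s
  refine max_le ?_ ?_
  · rcases le_max_iff.mp h1 with h | h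
    · exact (nsmul_le_nsmul_right h 2).trans ((le_max_left _ _).trans (le_max_left _ _))
    · exact (nsmul_le_nsmul_right h 2).trans ((le_max_left _ _).trans (le_max_right _ _))
  · rcases le_max_iff.mp h2 with h | h
    · exact (add_le_add_left (nsmul_le_nsmul_right h 2) 3).trans
        ((le_max_right _ _).trans (le_max_left _ _))
    · exact (add_le_add_left (nsmul_le_nsmul_right h 2) 3).trans
        ((le_max_right _ _).trans (le_max_right _ _))

lemma poleOrder_add {f g : W.toAffine.CoordinateRing} (hf : f ≠ 0) (hg : g ≠ 0) (h : f + g ≠ 0) :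
    poleOrder W (f + g) ≤ max (poleOrder W f) (poleOrder W g) := by
  have := degree_norm_add_le W f g
  rw [degree_eq_natDegree (norm_ne_zero W hf), degree_eq_natDegree (norm_ne_zero W hg),
    degree_eq_natDegree (norm_ne_zero W h)] at this
  unfold poleOrder
  rcases le_max_iff.mp this with h | h
  · exact le_max_of_le_left (by exact_mod_cast h)
  · exact le_max_of_le_right (by exact_mod_cast h)

open Classical in
/-- The multiplicative valuation `f ↦ exp (- ord_O f)` on the affine coordinate ring `F[x, y]`. -/
def ringInftyValuation : Valuation W.toAffine.CoordinateRing ℤᵐ⁰ where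
  toFun f := if f = 0 then 0 else WithZero.exp (poleOrder W f : ℤ)
  map_zero' := if_pos rfl
  map_one' := by simp [poleOrder]
  map_mul' f g := by
    by_cases hf : f = 0
    · simp [hf]
    by_cases hg : g = 0
    · simp [hg]
    simp [hf, hg, poleOrder_mul W hf hg, WithZero.exp_add]
  map_add_le_max' f g := by
    by_cases hf : f = 0
    · simp [hf]
    by_cases hg : g = 0
    · simp [hg]
    by_cases h : f + g = 0
    · simp [h]
    simp only [hf, hg, h, if_false]
    rcases le_max_iff.mp (poleOrder_add W hf hg h) with h | h
    · exact le_max_of_le_left <| WithZero.exp_le_exp.mpr <| by exact_mod_cast h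
    · exact le_max_of_le_right <| WithZero.exp_le_exp.mpr <| by exact_mod_cast h

lemma nonZeroDivisors_le_primeCompl :
    W.toAffine.CoordinateRing⁰ ≤ (ringInftyValuation W).supp.primeCompl := by
  intro f hf h
  have hf0 : f ≠ 0 := nonZeroDivisors.ne_zero hf
  have h0 : ringInftyValuation W f = 0 := (Valuation.mem_supp_iff _ _).mp h
  simp [ringInftyValuation, hf0] at h0

/-- The valuation `exp (- ord_O)` of the function field `E` at infinity. -/
def inftyValuation : Valuation (FunField W) ℤᵐ⁰ :=
  (ringInftyValuation W).extendToLocalization (nonZeroDivisors_le_primeCompl W) (FunField W)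

/-- The infinite place `O` of `E`, the common pole of `x` and `y`, given by its valuation ring. -/
def inftyPlace : ValuationSubring (FunField W) := (inftyValuation W).valuationSubring

/-- `Aut(E, O) = {σ ∈ Aut(E/F) : σ(O) = O}`, the stabilizer of the infinite place under the action
of `Aut(E/F)` on the places (that is, on the valuation rings) of `E`. -/
def autO : Subgroup (Aut W) := MulAction.stabilizer (Aut W) (inftyPlace W)

/-! ### Translations -/

/-- The element `x` of `E`. -/
def xGen : FunField W := algebraMap W.toAffine.CoordinateRing _ (CoordinateRing.mk W (C X))

/-- The element `y` of `E`. -/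
def yGen : FunField W := algebraMap W.toAffine.CoordinateRing _ (CoordinateRing.mk W X)

lemma equation_gen : (W.toAffine⁄(FunField W)).Equation (xGen W) (yGen W) := by
  have h : CoordinateRing.mk W.toAffine (X ^ 2 + C (C W.a₁ * X + C W.a₃) * X -
      C (X ^ 3 + C W.a₂ * X ^ 2 + C W.a₄ * X + C W.a₆)) = 0 := AdjoinRoot.mk_self
  have h' := congr_arg (algebraMap W.toAffine.CoordinateRing (FunField W)) h
  have hC (a : F) : algebraMap F (FunField W) a =
      algebraMap W.toAffine.CoordinateRing (FunField W) (CoordinateRing.mk W (C (C a))) := by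
    rw [IsScalarTower.algebraMap_apply F W.toAffine.CoordinateRing (FunField W)]
    rfl
  have e : (xGen W) = algebraMap W.toAffine.CoordinateRing _ (CoordinateRing.mk W (C X)) := rfl
  have e' : (yGen W) = algebraMap W.toAffine.CoordinateRing _ (CoordinateRing.mk W X) := rfl
  simp only [map_add, map_sub, map_mul, map_pow, map_zero, ← hC, ← e, ← e'] at h'
  rw [equation_iff]
  simp only [baseChange_a₁, baseChange_a₂, baseChange_a₃, baseChange_a₄, baseChange_a₆]
  linear_combination h'

instance [W.IsElliptic] : (W.toAffine⁄(FunField W)).IsElliptic :=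
  inferInstanceAs (W.map (algebraMap F (FunField W))).IsElliptic

/-- The generic point `η = (x, y)` of the elliptic curve, an `E`-rational point. -/
def genericPoint [W.IsElliptic] : (W.toAffine⁄(FunField W)).Point :=
  .some (xGen W) (yGen W) (equation_iff_nonsingular.mp (equation_gen W))

open Classical in
/-- `σ ∈ Aut(E/F)` is the translation automorphism `τ_Q` for a rational point `Q`: it sends the
coordinates `x, y` of the generic point `η` to those of `η - Q` (sum in the group of `E`-rational
points). Equivalently, `(σ f)(P) = f (P - Q)` for all functions `f` and geometric points `P`, so
that `σ` sends the place of `E` at a point `P` to the place at `P + Q`. -/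
def IsTranslationBy [W.IsElliptic] (σ : Aut W) (Q : (W.toAffine⁄F).Point) : Prop :=
  Point.map σ.toAlgHom (genericPoint W) =
    genericPoint W - Point.baseChange F (FunField W) Q

open Classical in
lemma map_mul_point (σ τ : Aut W) (P : (W.toAffine⁄(FunField W)).Point) :
    Point.map (σ * τ : Aut W).toAlgHom P = Point.map σ.toAlgHom (Point.map τ.toAlgHom P) :=
  (Point.map_map τ.toAlgHom σ.toAlgHom P).symm

open Classical in
lemma map_one_point (P : (W.toAffine⁄(FunField W)).Point) :
    Point.map (1 : Aut W).toAlgHom P = P := by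
  cases P <;> rfl

open Classical in
/-- The translation group `T_E = {τ_Q : Q ∈ W(F)}`. -/
def translationGroup [W.IsElliptic] : Subgroup (Aut W) where
  carrier := {σ | ∃ Q, IsTranslationBy W σ Q}
  one_mem' := ⟨0, by rw [IsTranslationBy, map_zero, sub_zero, map_one_point]⟩
  mul_mem' := by
    rintro σ τ ⟨P, hP⟩ ⟨Q, hQ⟩
    refine ⟨P + Q, ?_⟩
    rw [IsTranslationBy] at hP hQ
    rw [IsTranslationBy, map_mul_point, hQ, map_sub, hP, Point.map_baseChange, map_add, sub_sub]
  inv_mem' := by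
    rintro σ ⟨P, hP⟩
    refine ⟨-P, ?_⟩
    rw [IsTranslationBy] at hP
    apply Point.map_injective (W' := W.toAffine) σ.toAlgHom
    rw [← map_mul_point, mul_inv_cancel, map_one_point, map_sub, hP, Point.map_baseChange, map_neg]
    abel

end EllipticFunctionField

end

/-! Splitting `1 → T_E ∩ G → G → π(G) → 1` amounts to finding a subgroup `C ≤ G` that meets `T_E`
trivially and has the same image as `G` under `π`. An automorphism is determined by the image of the
generic point `η`, so identities between automorphisms are checked in the group of `E`-rational
points.

The key fact is that lifts keep their order. If `ρ` in `Aut(E, O)` has order `n`, with `n` even or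
`n = 3`, then `η + ρη + ... + ρ^(n-1)η = 0`: for even `n` because `ρ^(n/2)` is negation, for `n = 3`
because the three conjugates of `η` are collinear. By `pow_eq_one_of_sum_eq_zero` every `g` with `π
g = ρ` then satisfies `g ^ n = 1`.

The elements of `Aut(E, O)` are admissible changes of variables `(u, r, s, t)`
(`exists_variableChange`), and `u¹² = 1`. If `ρ ↦ u` is injective on `π(G)`, then `π(G)` is cyclic
of order dividing 12, hence of even order or of order 1 or 3, and a lift of a generator (the
identity for order 1) generates `C`.

Otherwise a nontrivial element of `π(G)` has `u = 1`, and the characteristic is 2 or 3. In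
characteristic 3 this element generates a normal subgroup of order 3 in `π(G)`; in characteristic 2
negation lies in `π(G)` and is central. If the characteristic is 2 and `a₁ ≠ 0`, then `π(G) = {±1}`
is cyclic after all. In the other cases the normal cyclic subgroup fixes no nontrivial translation,
and a Frattini argument (`exists_complement_of_normal`) takes for `C` the normalizer in `G` of a
lift of it. -/

namespace EllipticFunctionField

/-! ### Splitting criteria for abstract groups. -/

section GroupTheory

variable {Γ Q : Type*} [Group Γ] [Group Q]

/-- A subgroup whose image under `π` is generated by `π g` is split over `ker π` as soon as
`g ^ n = 1`, where `n` is the order of `π g`. -/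
lemma exists_complement_of_zpowers (π : Γ →* Q) (G : Subgroup Γ) (g : Γ) (hg : g ∈ G)
    (hgen : ∀ h ∈ G, ∃ k : ℤ, π h = π g ^ k) (hord : g ^ orderOf (π g) = 1) :
    ∃ C ≤ G, C ⊓ π.ker = ⊥ ∧ ∀ h ∈ G, ∃ c ∈ C, π c = π h := by
  refine ⟨Subgroup.zpowers g, by simpa using hg, ?_, fun h hh ↦ ?_⟩
  · rw [eq_bot_iff]
    rintro _ ⟨⟨k, rfl⟩, hk⟩
    have hk' : π g ^ k = 1 := by simpa [MonoidHom.mem_ker] using hk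
    obtain ⟨m, rfl⟩ := orderOf_dvd_iff_zpow_eq_one.mpr hk'
    simp [zpow_mul, hord]
  · obtain ⟨k, hk⟩ := hgen h hh
    exact ⟨g ^ k, ⟨k, rfl⟩, by rw [map_zpow, hk]⟩

/-- A subgroup `G` whose image contains a cyclic normal subgroup, generated by `π g`, that acts
without fixed points on `ker π ∩ G`, is split over `ker π`: the normalizer of a lift of that cyclic
group is a complement. -/
lemma exists_complement_of_normal (π : Γ →* Q) (hcomm : ∀ a ∈ π.ker, ∀ b ∈ π.ker, a * b = b * a)
    (G : Subgroup Γ) [Finite ↥(π.ker ⊓ G)] (g : Γ) (hg : g ∈ G) (hord : g ^ orderOf (π g) = 1)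
    (hpos : 0 < orderOf (π g))
    (hnormal : ∀ h ∈ G, ∃ i : ℕ, π h * π g * (π h)⁻¹ = π g ^ i)
    (hfix : ∀ n ∈ π.ker ⊓ G, g * n * g⁻¹ = n → n = 1) :
    ∃ C ≤ G, C ⊓ π.ker = ⊥ ∧ ∀ h ∈ G, ∃ c ∈ C, π c = π h := by
  have hfin : IsOfFinOrder g := isOfFinOrder_iff_pow_eq_one.mpr ⟨_, hpos, hord⟩
  have hdisj : ∀ a ∈ Subgroup.zpowers g, a ∈ π.ker → a = 1 := by
    rintro _ ⟨k, rfl⟩ hk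
    have hk' : π g ^ k = 1 := by simpa [MonoidHom.mem_ker] using hk
    obtain ⟨m, rfl⟩ := orderOf_dvd_iff_zpow_eq_one.mpr hk'
    simp [zpow_mul, hord]
  let C : Subgroup Γ := G ⊓ Subgroup.normalizer (Subgroup.zpowers g : Set Γ)
  refine ⟨C, inf_le_left, ?_, fun x hx ↦ ?_⟩
  · rw [eq_bot_iff]
    rintro c ⟨⟨hcG, hcn⟩, hc⟩
    have h1 : c * g * c⁻¹ ∈ Subgroup.zpowers g :=
      (Subgroup.mem_normalizer_iff.mp hcn g).mp (Subgroup.mem_zpowers g)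
    -- For `c` in the kernel this commutator lies both in `⟨g⟩` and in `ker π`, which meet
    -- trivially. So `c` commutes with `g` and `hfix` applies.
    have h2 : g⁻¹ * (c * g * c⁻¹) = 1 := by
      refine hdisj _ (mul_mem (inv_mem (Subgroup.mem_zpowers g)) h1) ?_
      have : π c = 1 := hc
      simp [MonoidHom.mem_ker, this]
    refine hfix c ⟨hc, hcG⟩ ?_
    rw [inv_mul_eq_one] at h2
    calc g * c * g⁻¹ = (c * g * c⁻¹) * c * g⁻¹ := by rw [← h2]
      _ = c := by group
  · obtain ⟨i, hi⟩ := hnormal x hx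
    -- `m` measures how far `x` is from normalizing `⟨g⟩`. The aim is to correct `x` by some `n` in
    -- `ker π ⊓ G` so that `n⁻¹ * x` conjugates `g` to `g ^ i` exactly.
    set m := x * g * x⁻¹ * (g ^ i)⁻¹ with hm
    have hmN : m ∈ π.ker ⊓ G := by
      refine Subgroup.mem_inf.mpr ⟨?_, mul_mem (mul_mem (mul_mem hx hg) (inv_mem hx)) (inv_mem (pow_mem hg i))⟩
      rw [MonoidHom.mem_ker, hm, map_mul, map_mul, map_mul, map_inv, map_inv, map_pow, hi,
        mul_inv_cancel]
    have hconj : ∀ n ∈ π.ker ⊓ G, ∀ y ∈ G, y * n * y⁻¹ ∈ π.ker ⊓ G := fun n hn y hy ↦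
      Subgroup.mem_inf.mpr ⟨(MonoidHom.normal_ker π).conj_mem n hn.1 y, mul_mem (mul_mem hy hn.2) (inv_mem hy)⟩
    have hgi : g ^ i = m⁻¹ * (x * g * x⁻¹) := by rw [hm]; group
    -- In additive notation this is `1 - g ^ i` on the abelian group `ker π ⊓ G`. Absence of fixed
    -- points makes it injective, finiteness makes it surjective, and a preimage of `m` is the
    -- required correction.
    let f : ↥(π.ker ⊓ G) → ↥(π.ker ⊓ G) := fun n ↦
      n * ⟨g ^ i * (n : Γ)⁻¹ * (g ^ i)⁻¹, hconj _ (inv_mem n.2) _ (pow_mem hg i)⟩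
    -- `g ^ i` and `x * g * x⁻¹` differ by `m`, which acts trivially on the abelian kernel; so fixed
    -- points of `g ^ i` are `x`-conjugates of fixed points of `g`.
    have hact : ∀ n ∈ π.ker ⊓ G, g ^ i * n * (g ^ i)⁻¹ = n → n = 1 := by
      intro n hn h
      have h3 := hconj n hn _ (mul_mem (mul_mem hx hg) (inv_mem hx))
      have h4 : x * g * x⁻¹ * n * (x * g * x⁻¹)⁻¹ = n := by
        have h5 := hcomm _ (inv_mem hmN.1) _ h3.1
        have h6 : m⁻¹ * (x * g * x⁻¹ * n * (x * g * x⁻¹)⁻¹) * m = n := by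
          calc m⁻¹ * (x * g * x⁻¹ * n * (x * g * x⁻¹)⁻¹) * m = g ^ i * n * (g ^ i)⁻¹ := by
                rw [hgi]; group
            _ = n := h
        rwa [h5, inv_mul_cancel_right] at h6
      have h7 := hfix (x⁻¹ * n * x) (by simpa using hconj n hn x⁻¹ (inv_mem hx)) (by
        calc g * (x⁻¹ * n * x) * g⁻¹ = x⁻¹ * (x * g * x⁻¹ * n * (x * g * x⁻¹)⁻¹) * x := by group
          _ = _ := by rw [h4])
      calc n = x * (x⁻¹ * n * x) * x⁻¹ := by group
        _ = 1 := by rw [h7]; group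
    have hinj : Function.Injective f := by
      rintro ⟨a, ha⟩ ⟨b, hb⟩ hab
      have hab' : a * (g ^ i * a⁻¹ * (g ^ i)⁻¹) = b * (g ^ i * b⁻¹ * (g ^ i)⁻¹) :=
        congr_arg Subtype.val hab
      have h8 : b⁻¹ * a = 1 := by
        refine hact _ (mul_mem (inv_mem hb) ha) ?_
        have h9 : a = b * (g ^ i * b⁻¹ * (g ^ i)⁻¹) * (g ^ i * a⁻¹ * (g ^ i)⁻¹)⁻¹ := by
          rw [← hab', mul_inv_cancel_right]
        nth_rewrite 2 [h9]
        group
      exact Subtype.ext (inv_mul_eq_one.mp h8).symm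
    obtain ⟨⟨n, hn⟩, hfn⟩ := Finite.surjective_of_injective hinj ⟨m, hmN⟩
    have hfn' : n * (g ^ i * n⁻¹ * (g ^ i)⁻¹) = m := congr_arg Subtype.val hfn
    have hng : n⁻¹ * x * g * (n⁻¹ * x)⁻¹ = g ^ i := by
      have : x * g * x⁻¹ = n * (g ^ i * n⁻¹ * (g ^ i)⁻¹) * g ^ i := by rw [hfn', hm]; group
      calc n⁻¹ * x * g * (n⁻¹ * x)⁻¹ = n⁻¹ * (x * g * x⁻¹) * n := by group
        _ = g ^ i := by rw [this]; group
    refine ⟨n⁻¹ * x, Subgroup.mem_inf.mpr ⟨mul_mem (inv_mem hn.2) hx, ?_⟩, ?_⟩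
    -- For a finite subgroup, being mapped into itself by conjugation is enough to be normalized.
    · have : Finite (Subgroup.zpowers g : Set Γ) := hfin.finite_zpowers
      refine Subgroup.mem_normalizer_fintype ?_
      rintro _ ⟨k, rfl⟩
      refine ⟨i * k, ?_⟩
      simp only
      rw [← conj_zpow, hng, ← zpow_natCast, ← zpow_mul]
    · have : π n = 1 := hn.1
      rw [map_mul, map_inv, this, inv_one, one_mul]

/-- If a group `Γ` is the product of a commutative normal subgroup `T` and a complement `B`, and
every subgroup `G` of `Γ` contains a complement of `T ⊓ G` in `G`, then each `G` is the semidirect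
product of `T ⊓ G` and its projection to `B`. -/
lemma exists_semidirectProduct (T B : Subgroup Γ) [T.Normal]
    (hcomm : ∀ a ∈ T, ∀ b ∈ T, a * b = b * a) (π : Γ →* B) (hker : π.ker = T)
    (hπ : ∀ b : B, π b = b) (G : Subgroup Γ)
    (hsplit : ∃ C ≤ G, C ⊓ π.ker = ⊥ ∧ ∀ h ∈ G, ∃ c ∈ C, π c = π h) :
    ∃ φ : G.map π →* MulAut ↥(T ⊓ G),
      (∀ (ρ : G.map π) (τ : ↥(T ⊓ G)), ((φ ρ τ : Γ)) = (ρ : B) * τ * ((ρ : B) : Γ)⁻¹) ∧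
      ∃ e : (↥(T ⊓ G) ⋊[φ] G.map π) ≃* G,
        (∀ τ, ((e (SemidirectProduct.inl τ) : G) : Γ) = τ) ∧ ∀ a, π (e a) = a.right := by
  subst hker
  obtain ⟨C, hCG, hC, hCπ⟩ := hsplit
  -- the projection of `C` to `π(G)` is an isomorphism
  let p : C →* G.map π := (π.comp C.subtype).codRestrict _ fun c ↦ ⟨c, hCG c.2, rfl⟩
  have hp : Function.Bijective p := by
    refine ⟨(injective_iff_map_eq_one p).mpr fun c hc ↦ ?_, ?_⟩
    · have h1 : π c = 1 := congr_arg Subtype.val hc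
      have h2 : (c : Γ) ∈ C ⊓ π.ker := Subgroup.mem_inf.mpr ⟨c.2, h1⟩
      rw [hC, Subgroup.mem_bot] at h2
      exact Subtype.ext h2
    · rintro ⟨_, h, hh, rfl⟩
      obtain ⟨c, hc, hch⟩ := hCπ h hh
      exact ⟨⟨c, hc⟩, Subtype.ext hch⟩
  let s : G.map π →* G := (Subgroup.inclusion hCG).comp (MulEquiv.ofBijective p hp).symm.toMonoidHom
  have hs (ρ : G.map π) : π (s ρ) = ρ :=
    congr_arg Subtype.val ((MulEquiv.ofBijective p hp).apply_symm_apply ρ)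
  -- The element `ρ` of `B` need not lie in `G`, but it differs from its lift `s ρ` by an element of
  -- the commutative group `ker π`. Both therefore act alike, and conjugation by `ρ` preserves `ker
  -- π ⊓ G`.
  have hconj (ρ : G.map π) (τ : Γ) (hτ : τ ∈ π.ker) :
      (s ρ : Γ) * τ * (s ρ : Γ)⁻¹ = (ρ : B) * τ * ((ρ : B) : Γ)⁻¹ := by
    have h1 : ((ρ : B) : Γ)⁻¹ * s ρ ∈ π.ker := by
      rw [MonoidHom.mem_ker, map_mul, map_inv, hs, hπ, inv_mul_cancel]
    calc (s ρ : Γ) * τ * (s ρ : Γ)⁻¹ =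
        (ρ : B) * ((((ρ : B) : Γ)⁻¹ * s ρ) * τ) * (((ρ : B) : Γ)⁻¹ * s ρ)⁻¹ * ((ρ : B) : Γ)⁻¹ := by
          group
      _ = _ := by rw [hcomm _ h1 _ hτ]; group
  have hnorm (g : G) : (g : Γ) ∈ Subgroup.normalizer ((π.ker ⊓ G : Subgroup Γ) : Set Γ) := by
    refine Subgroup.mem_normalizer_iff.mpr fun n ↦ ?_
    rw [Subgroup.mem_inf, Subgroup.mem_inf, Subgroup.mul_mem_cancel_right _ (inv_mem g.2),
      Subgroup.mul_mem_cancel_left _ g.2]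
    exact and_congr_left fun _ ↦ Subgroup.Normal.mem_comm_iff inferInstance |>.trans (by simp) |>.symm
  let φ : G.map π →* MulAut ↥(π.ker ⊓ G) :=
    (Subgroup.normalizerMonoidHom (π.ker ⊓ G)).comp
      ((G.subtype.codRestrict _ hnorm).comp s)
  have hφ (ρ : G.map π) (τ : ↥(π.ker ⊓ G)) : (φ ρ τ : Γ) = (s ρ : Γ) * τ * (s ρ : Γ)⁻¹ := rfl
  refine ⟨φ, fun ρ τ ↦ by rw [hφ, hconj _ _ τ.2.1], ?_⟩
  let l : (↥(π.ker ⊓ G) ⋊[φ] G.map π) →* G :=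
    SemidirectProduct.lift (Subgroup.inclusion inf_le_right) s fun ρ ↦ by
      ext τ
      rfl
  have hl (a) : (l a : Γ) = a.left * s a.right := rfl
  have hπl (a) : π (l a) = a.right := by
    rw [hl, map_mul, hs, show π a.left = 1 from a.left.2.1, one_mul]
  have hbij : Function.Bijective l := by
    refine ⟨(injective_iff_map_eq_one l).mpr fun a ha ↦ ?_, fun g ↦ ?_⟩
    · have h1 : a.right = 1 := Subtype.ext (by rw [← hπl, ha]; simp)
      have h2 : (a.left : Γ) = 1 := by
        have := hl a
        rwa [ha, h1, map_one, OneMemClass.coe_one, mul_one, eq_comm] at this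
      exact SemidirectProduct.ext (Subtype.ext h2) h1
    · let ρ : G.map π := ⟨π g, g, g.2, rfl⟩
      refine ⟨⟨⟨g * (s ρ : Γ)⁻¹, Subgroup.mem_inf.mpr ⟨?_, mul_mem g.2 (inv_mem (s ρ).2)⟩⟩, ρ⟩, ?_⟩
      · rw [MonoidHom.mem_ker, map_mul, map_inv, hs, mul_inv_cancel]
      · exact Subtype.ext (by rw [hl]; simp)
  refine ⟨MulEquiv.ofBijective l hbij, fun τ ↦ ?_, fun a ↦ hπl a⟩
  change (l (SemidirectProduct.inl τ) : Γ) = τ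
  rw [hl]
  simp

end GroupTheory

end EllipticFunctionField

/-! ### Pole orders and the uniqueness of the place with a pole at `x`. -/

noncomputable section

namespace EllipticFunctionField

open WeierstrassCurve WeierstrassCurve.Affine Polynomial

variable {F : Type*} [Field F] (W : WeierstrassCurve F)

/-! ### Valuations with a pole at `x` -/

lemma algebraMap_mk_C (p : F[X]) :
    algebraMap W.toAffine.CoordinateRing (FunField W) (CoordinateRing.mk W (C p)) =
      aeval (xGen W) p := by
  have h : aeval (CoordinateRing.mk W.toAffine (C X)) p = CoordinateRing.mk W (C p) := by
    have := aeval_algebraMap_apply W.toAffine.CoordinateRing (X : F[X]) p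
    rwa [aeval_X_left_apply] at this
  rw [← h, ← aeval_algebraMap_apply]
  rfl

lemma algebraMap_smul_basis (p q : F[X]) :
    algebraMap W.toAffine.CoordinateRing (FunField W)
      (p • (1 : W.toAffine.CoordinateRing) + q • CoordinateRing.mk W X) =
      aeval (xGen W) p + aeval (xGen W) q * yGen W := by
  rw [CoordinateRing.smul, CoordinateRing.smul, map_add, map_mul, map_mul, map_one, mul_one,
    algebraMap_mk_C, algebraMap_mk_C]
  rfl

lemma exists_algebraMap_eq (f : W.toAffine.CoordinateRing) :
    ∃ p q : F[X], f = p • (1 : W.toAffine.CoordinateRing) + q • CoordinateRing.mk W X ∧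
      algebraMap W.toAffine.CoordinateRing (FunField W) f =
        aeval (xGen W) p + aeval (xGen W) q * yGen W := by
  obtain ⟨p, q, rfl⟩ := CoordinateRing.exists_smul_basis_eq f
  exact ⟨p, q, rfl, algebraMap_smul_basis W p q⟩

lemma aeval_add_aeval_mul_eq_zero {p q : F[X]}
    (h : aeval (xGen W) p + aeval (xGen W) q * yGen W = 0) : p = 0 ∧ q = 0 := by
  rw [← algebraMap_smul_basis, FaithfulSMul.algebraMap_eq_zero_iff] at h
  exact CoordinateRing.smul_basis_eq_zero h

lemma poleOrder_smul_one {p : F[X]} (hp : p ≠ 0) :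
    poleOrder W (p • (1 : W.toAffine.CoordinateRing)) = 2 * p.natDegree := by
  have h := CoordinateRing.degree_norm_smul_basis (W' := W.toAffine) p 0
  rw [zero_smul, add_zero, degree_zero, two_nsmul ⊥, WithBot.bot_add, WithBot.bot_add,
    max_bot_right, degree_eq_natDegree hp, nsmul_eq_mul] at h
  exact natDegree_eq_of_degree_eq_some (by exact_mod_cast h)

/-- The case `p = 0` needs no exception: its `natDegree` is 0, and the second entry is at least 3.
-/
lemma poleOrder_smul_basis (p : F[X]) {q : F[X]} (hq : q ≠ 0) :
    poleOrder W (p • (1 : W.toAffine.CoordinateRing) + q • CoordinateRing.mk W X) =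
      max (2 * p.natDegree) (2 * q.natDegree + 3) := by
  have h := CoordinateRing.degree_norm_smul_basis (W' := W.toAffine) p q
  refine natDegree_eq_of_degree_eq_some (h.trans ?_)
  rw [degree_eq_natDegree hq, nsmul_eq_mul, nsmul_eq_mul]
  by_cases hp : p = 0
  · simp only [hp, degree_zero, natDegree_zero, mul_zero, Nat.zero_max]
    rw [WithBot.mul_bot (by norm_num), max_bot_left]
    norm_cast
  · rw [degree_eq_natDegree hp]
    norm_cast

lemma poleOrder_cases {p q : F[X]} {N : ℕ}
    (h : p • (1 : W.toAffine.CoordinateRing) + q • CoordinateRing.mk W X ≠ 0)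
    (hN : poleOrder W (p • (1 : W.toAffine.CoordinateRing) + q • CoordinateRing.mk W X) = N) :
    (p = 0 ∨ 2 * p.natDegree ≤ N) ∧ (q = 0 ∨ 2 * q.natDegree + 3 ≤ N) ∧
      ((p ≠ 0 ∧ 2 * p.natDegree = N) ∨ (q ≠ 0 ∧ 2 * q.natDegree + 3 = N)) := by
  by_cases hq : q = 0
  · have hp : p ≠ 0 := by
      rintro rfl
      simp [hq] at h
    rw [hq, zero_smul, add_zero, poleOrder_smul_one W hp] at hN
    grind
  · rw [poleOrder_smul_basis W p hq] at hN
    by_cases hp : p = 0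
    · simp only [hp, natDegree_zero] at hN ⊢
      grind
    · grind

lemma poleOrder_lt {p q : F[X]} {N : ℕ}
    (h : p • (1 : W.toAffine.CoordinateRing) + q • CoordinateRing.mk W X ≠ 0)
    (hp : p = 0 ∨ 2 * p.natDegree < N) (hq : q = 0 ∨ 2 * q.natDegree + 3 < N) :
    poleOrder W (p • (1 : W.toAffine.CoordinateRing) + q • CoordinateRing.mk W X) < N := by
  obtain ⟨-, -, h1⟩ := poleOrder_cases W h rfl
  grind

omit W in
lemma exists_sub_C_mul_natDegree_lt {p q : F[X]} (hq : q ≠ 0) (h : p.natDegree = q.natDegree) :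
    ∃ c : F, p - C c * q = 0 ∨ (p - C c * q).natDegree < q.natDegree := by
  by_cases hp : p = 0
  · exact ⟨0, Or.inl (by simp [hp])⟩
  have hc : p.leadingCoeff / q.leadingCoeff ≠ 0 :=
    div_ne_zero (leadingCoeff_ne_zero.mpr hp) (leadingCoeff_ne_zero.mpr hq)
  refine ⟨p.leadingCoeff / q.leadingCoeff, or_iff_not_imp_left.mpr fun h0 ↦ ?_⟩
  rw [← h]
  refine natDegree_lt_natDegree h0 (degree_sub_lt_left ?_ hp ?_)
  · rw [degree_C_mul hc, degree_eq_natDegree hp, degree_eq_natDegree hq, h]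
  · rw [leadingCoeff_mul, leadingCoeff_C, div_mul_cancel₀ _ (leadingCoeff_ne_zero.mpr hq)]

/-- The contributions `2 deg p` and `2 deg q + 3` have different parity, so equal pole orders come
from the same kind of leading term, which a constant multiple cancels. This is what makes the
residue field at infinity equal to `F`. -/
lemma exists_sub_smul_poleOrder_lt {a b : W.toAffine.CoordinateRing} (ha : a ≠ 0) (hb : b ≠ 0)
    (h : poleOrder W a = poleOrder W b) :
    ∃ c : F, a - (C c : F[X]) • b = 0 ∨ poleOrder W (a - (C c : F[X]) • b) < poleOrder W b := by
  obtain ⟨p, q, rfl⟩ := CoordinateRing.exists_smul_basis_eq a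
  obtain ⟨r, s, rfl⟩ := CoordinateRing.exists_smul_basis_eq b
  obtain ⟨h1, h2, h3⟩ := poleOrder_cases W ha h
  obtain ⟨h4, h5, h6⟩ := poleOrder_cases W hb rfl
  generalize poleOrder W (r • (1 : W.toAffine.CoordinateRing) + s • CoordinateRing.mk W X) = N at *
  have hsub (c : F) : (p • (1 : W.toAffine.CoordinateRing) + q • CoordinateRing.mk W X) -
      (C c : F[X]) • (r • (1 : W.toAffine.CoordinateRing) + s • CoordinateRing.mk W X) =
      (p - C c * r) • (1 : W.toAffine.CoordinateRing) + (q - C c * s) • CoordinateRing.mk W X := by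
    simp only [smul_add, smul_smul, sub_smul]
    ring
  have hle (c : F) (f g : F[X]) : (f - C c * g).natDegree ≤ max f.natDegree g.natDegree :=
    (natDegree_sub_le _ _).trans (max_le_max le_rfl (natDegree_C_mul_le c g))
  suffices hc : ∃ c : F, (p - C c * r = 0 ∨ 2 * (p - C c * r).natDegree < N) ∧
      (q - C c * s = 0 ∨ 2 * (q - C c * s).natDegree + 3 < N) by
    obtain ⟨c, hc1, hc2⟩ := hc
    refine ⟨c, or_iff_not_imp_left.mpr fun h0 ↦ ?_⟩
    rw [hsub] at h0 ⊢
    exact poleOrder_lt W h0 hc1 hc2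
  rcases h6 with ⟨hr, hN⟩ | ⟨hs, hN⟩
  · have hp : p.natDegree = r.natDegree := by omega
    obtain ⟨c, hc⟩ := exists_sub_C_mul_natDegree_lt hr hp
    refine ⟨c, hc.imp_right fun _ ↦ by omega, ?_⟩
    have := hle c q s
    by_cases hq : q = 0 <;> by_cases hs : s = 0
    · simp [hq, hs]
    all_goals
      right
      simp only [hq, hs, false_or, natDegree_zero] at *
      omega
  · have hq : q.natDegree = s.natDegree := by omega
    obtain ⟨c, hc⟩ := exists_sub_C_mul_natDegree_lt hs hq
    refine ⟨c, ?_, hc.imp_right fun _ ↦ by omega⟩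
    have := hle c p r
    by_cases hp : p = 0 <;> by_cases hr : r = 0
    · simp [hp, hr]
    all_goals
      right
      simp only [hp, hr, false_or, natDegree_zero] at *
      omega

local notation "ι" => algebraMap F (FunField W)

lemma gen_relation : yGen W ^ 2 + ι W.a₁ * xGen W * yGen W + ι W.a₃ * yGen W =
    xGen W ^ 3 + ι W.a₂ * xGen W ^ 2 + ι W.a₄ * xGen W + ι W.a₆ :=
  ((W.toAffine⁄(FunField W)).equation_iff _ _).mp (equation_gen W)

section Valuation

variable {W} {Γ₀ : Type*} [LinearOrderedCommGroupWithZero Γ₀] (w : Valuation (FunField W) Γ₀)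
  [w.IsTrivialOn F]

omit [w.IsTrivialOn F] in
lemma map_algebraMap_le_one [w.IsTrivialOn F] (a : F) : w (ι a) ≤ 1 := by
  rcases eq_or_ne a 0 with rfl | ha
  · simp
  · exact (Valuation.IsTrivialOn.eq_one a ha).le

variable (hx : 1 < w (xGen W))
include hx

/-- In `y(y + a₁x + a₃) = x³ + a₂x² + a₄x + a₆` the right side has value `w(x)³`. This forces `w(y)
> w(x)`, so `y` dominates `a₁x + a₃`. -/
lemma map_yGen_sq : w (yGen W) ^ 2 = w (xGen W) ^ 3 := by
  have h1 : w (aeval (xGen W) (X ^ 3 + C W.a₂ * X ^ 2 + C W.a₄ * X + C W.a₆)) =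
      w (xGen W) ^ 3 := by
    have hd : (X ^ 3 + C W.a₂ * X ^ 2 + C W.a₄ * X + C W.a₆ : F[X]).natDegree = 3 := by
      rw [← one_mul (X ^ 3), ← C_1, natDegree_cubic one_ne_zero]
    rw [valuation_aeval_eq_valuation_X_pow_natDegree_of_one_lt_valuation_X _ hx, hd]
    intro h
    rw [h] at hd
    simp at hd
  have h2 : yGen W * (yGen W + (ι W.a₁ * xGen W + ι W.a₃)) =
      aeval (xGen W) (X ^ 3 + C W.a₂ * X ^ 2 + C W.a₄ * X + C W.a₆) := by
    simp only [map_add, map_mul, map_pow, aeval_X, aeval_C]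
    linear_combination gen_relation W
  have hpos : 0 < w (xGen W) := zero_lt_one.trans hx
  have h3 : w (ι W.a₁ * xGen W + ι W.a₃) ≤ w (xGen W) := by
    refine w.map_add_le ?_ ((map_algebraMap_le_one w _).trans hx.le)
    rw [map_mul]
    exact mul_le_of_le_one_left' (map_algebraMap_le_one w _)
  have h4 : w (xGen W) < w (yGen W) := by
    by_contra! h
    have h5 : w (xGen W) ^ 3 ≤ w (xGen W) ^ 2 := by
      rw [← h1, ← h2, map_mul, sq]
      exact mul_le_mul' h (w.map_add_le h h3)
    exact absurd h5 (not_le.mpr (pow_lt_pow_right₀ hx (by norm_num)))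
  rw [← h1, ← h2, map_mul, w.map_add_eq_of_lt_left (h3.trans_lt h4), sq]

/-- In `p(x) + q(x) y` the squared values of the two summands are an even and an odd power of
`w(x)`, so they cannot cancel. Hence `w(x)` and the pole order determine `w` on `F[x, y]`. -/
lemma map_algebraMap_sq {f : W.toAffine.CoordinateRing} (hf : f ≠ 0) :
    w (algebraMap _ (FunField W) f) ^ 2 = w (xGen W) ^ poleOrder W f := by
  obtain ⟨p, q, rfl, h⟩ := exists_algebraMap_eq W f
  have hpos : 0 < w (xGen W) := zero_lt_one.trans hx
  have hp (hp0 : p ≠ 0) : w (aeval (xGen W) p) ^ 2 = w (xGen W) ^ (2 * p.natDegree) := by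
    rw [valuation_aeval_eq_valuation_X_pow_natDegree_of_one_lt_valuation_X _ hx hp0, ← pow_mul,
      mul_comm]
  have hq (hq0 : q ≠ 0) :
      w (aeval (xGen W) q * yGen W) ^ 2 = w (xGen W) ^ (2 * q.natDegree + 3) := by
    rw [map_mul, mul_pow, map_yGen_sq w hx,
      valuation_aeval_eq_valuation_X_pow_natDegree_of_one_lt_valuation_X _ hx hq0, ← pow_mul,
      mul_comm, pow_add, mul_comm 2, mul_comm]
  rw [h]
  by_cases hq0 : q = 0
  · have hp0 : p ≠ 0 := by
      rintro rfl
      simp [hq0] at hf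
    rw [hq0, zero_smul, add_zero, poleOrder_smul_one W hp0, map_zero, zero_mul, add_zero, hp hp0]
  · rw [poleOrder_smul_basis W p hq0]
    have hp' (h : 2 * q.natDegree + 3 < 2 * p.natDegree) : p ≠ 0 := by
      rintro rfl
      simp at h
    rcases lt_or_gt_of_ne (show 2 * p.natDegree ≠ 2 * q.natDegree + 3 by omega) with hlt | hlt
    · rw [max_eq_right hlt.le, w.map_add_eq_of_lt_right, hq hq0]
      rw [← pow_lt_pow_iff_left₀ zero_le zero_le two_ne_zero, hq hq0]
      by_cases hp0 : p = 0
      · simp [hp0, hpos]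
      rw [hp hp0]
      exact pow_lt_pow_right₀ hx hlt
    · rw [max_eq_left hlt.le, w.map_add_eq_of_lt_left, hp (hp' hlt)]
      rw [← pow_lt_pow_iff_left₀ zero_le zero_le two_ne_zero, hp (hp' hlt), hq hq0]
      exact pow_lt_pow_right₀ hx hlt

lemma le_one_iff_poleOrder_le {f g : W.toAffine.CoordinateRing} (hf : f ≠ 0) (hg : g ≠ 0) :
    w (algebraMap _ (FunField W) f / algebraMap _ (FunField W) g) ≤ 1 ↔
      poleOrder W f ≤ poleOrder W g := by
  have hg' : 0 < w (algebraMap _ (FunField W) g) := by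
    rw [zero_lt_iff, Valuation.ne_zero_iff]
    exact (FaithfulSMul.algebraMap_eq_zero_iff _ _).not.mpr hg
  rw [map_div₀, div_le_one₀ hg', ← pow_le_pow_iff_left₀ zero_le zero_le two_ne_zero,
    map_algebraMap_sq w hx hf, map_algebraMap_sq w hx hg, pow_le_pow_iff_right₀ hx]

/-- The infinite place is the only place that is a pole of `x`. -/
lemma le_one_iff_le_one {Γ₁ : Type*} [LinearOrderedCommGroupWithZero Γ₁]
    (w' : Valuation (FunField W) Γ₁) [w'.IsTrivialOn F] (hx' : 1 < w' (xGen W)) (f : FunField W) :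
    w f ≤ 1 ↔ w' f ≤ 1 := by
  obtain ⟨a, b, hb, rfl⟩ := IsFractionRing.div_surjective (A := W.toAffine.CoordinateRing) f
  by_cases ha : a = 0
  · simp [ha]
  · have hb0 := nonZeroDivisors.ne_zero hb
    rw [le_one_iff_poleOrder_le w hx ha hb0, le_one_iff_poleOrder_le w' hx' ha hb0]

end Valuation

/-! ### The infinite place -/

lemma inftyValuation_algebraMap (f : W.toAffine.CoordinateRing) :
    inftyValuation W (algebraMap _ _ f) = ringInftyValuation W f :=
  Valuation.extendToLocalization_apply_map_apply _ _ _ _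

lemma inftyValuation_algebraMap_of_ne_zero {f : W.toAffine.CoordinateRing} (hf : f ≠ 0) :
    inftyValuation W (algebraMap _ _ f) = WithZero.exp (poleOrder W f : ℤ) := by
  rw [inftyValuation_algebraMap]
  exact if_neg hf

instance : (inftyValuation W).IsTrivialOn F where
  eq_one a ha := by
    have h : ι a = algebraMap W.toAffine.CoordinateRing (FunField W)
        ((C a : F[X]) • (1 : W.toAffine.CoordinateRing)) := by
      have := algebraMap_smul_basis W (C a) 0
      rw [zero_smul, add_zero] at this
      rw [this]
      simp
    have ha' : (C a : F[X]) ≠ 0 := C_ne_zero.mpr ha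
    rw [h, inftyValuation_algebraMap_of_ne_zero, poleOrder_smul_one W ha', natDegree_C]
    · simp
    · rw [Ne, ← FaithfulSMul.algebraMap_eq_zero_iff W.toAffine.CoordinateRing (FunField W), ← h]
      simpa using ha

lemma xGen_eq : xGen W = algebraMap W.toAffine.CoordinateRing (FunField W)
    ((X : F[X]) • (1 : W.toAffine.CoordinateRing)) := by
  have := algebraMap_smul_basis W X 0
  rw [zero_smul, add_zero] at this
  rw [this]
  simp

lemma inftyValuation_xGen : inftyValuation W (xGen W) = WithZero.exp 2 := by
  have hX : (X : F[X]) • (1 : W.toAffine.CoordinateRing) ≠ 0 := fun h ↦ X_ne_zero (R := F)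
    (CoordinateRing.smul_basis_eq_zero (W' := W.toAffine) (q := 0) (by rw [h, zero_smul, add_zero])).1
  rw [xGen_eq, inftyValuation_algebraMap_of_ne_zero W hX, poleOrder_smul_one W X_ne_zero,
    natDegree_X]
  rfl

lemma one_lt_inftyValuation_xGen : 1 < inftyValuation W (xGen W) := by
  rw [inftyValuation_xGen, ← WithZero.exp_zero, WithZero.exp_lt_exp]
  norm_num

lemma inftyValuation_yGen : inftyValuation W (yGen W) = WithZero.exp 3 := by
  have h := map_yGen_sq (inftyValuation W) (one_lt_inftyValuation_xGen W)
  rw [inftyValuation_xGen] at h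
  have h' : (WithZero.exp 3 : ℤᵐ⁰) ^ 2 = (WithZero.exp 2) ^ 3 := by
    rw [← WithZero.exp_nsmul, ← WithZero.exp_nsmul]; rfl
  exact (pow_left_inj₀ zero_le zero_le two_ne_zero).mp (h.trans h'.symm)

/-- The residue field at infinity is `F`. -/
lemma exists_inftyValuation_sub_lt_one {f : FunField W} (hf : inftyValuation W f ≤ 1) :
    ∃ a : F, inftyValuation W (f - ι a) < 1 := by
  obtain ⟨a, b, hb, rfl⟩ := IsFractionRing.div_surjective (A := W.toAffine.CoordinateRing) f
  have hb0 := nonZeroDivisors.ne_zero hb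
  rcases hf.lt_or_eq with hlt | heq
  · exact ⟨0, by simpa using hlt⟩
  have ha0 : a ≠ 0 := by
    rintro rfl
    simp at heq
  have hb1 : inftyValuation W (algebraMap _ _ b) ≠ 0 := by
    rw [inftyValuation_algebraMap_of_ne_zero W hb0]
    exact WithZero.exp_ne_zero
  have hab : poleOrder W a = poleOrder W b := by
    rw [map_div₀, div_eq_one_iff_eq hb1, inftyValuation_algebraMap_of_ne_zero W ha0,
      inftyValuation_algebraMap_of_ne_zero W hb0, WithZero.exp_inj] at heq
    exact_mod_cast heq
  obtain ⟨c, hc⟩ := exists_sub_smul_poleOrder_lt W ha0 hb0 hab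
  refine ⟨c, ?_⟩
  have h1 : algebraMap _ (FunField W) a / algebraMap _ (FunField W) b - ι c =
      algebraMap _ (FunField W) (a - (C c : F[X]) • b) / algebraMap _ (FunField W) b := by
    have hb2 : algebraMap _ (FunField W) b ≠ 0 :=
      (FaithfulSMul.algebraMap_eq_zero_iff _ _).not.mpr hb0
    rw [CoordinateRing.smul, map_sub, map_mul, algebraMap_mk_C, aeval_C]
    field_simp
  rw [h1, map_div₀, div_lt_one₀ (zero_lt_iff.mpr hb1)]
  by_cases h0 : a - (C c : F[X]) • b = 0
  · rw [h0, map_zero, map_zero]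
    exact zero_lt_iff.mpr hb1
  · rw [inftyValuation_algebraMap_of_ne_zero W h0, inftyValuation_algebraMap_of_ne_zero W hb0,
      WithZero.exp_lt_exp]
    exact_mod_cast hc.resolve_left h0

/-- The base field is algebraically closed in the function field. -/
lemma exists_algebraMap_eq_of_isAlgebraic {f : FunField W} (hf : IsAlgebraic F f) :
    ∃ a : F, ι a = f := by
  have h1 {g : FunField W} (hg : IsAlgebraic F g) (h0 : g ≠ 0) : inftyValuation W g = 1 := by
    by_contra h
    exact Valuation.transcendental_of_ne_one F g h0 h hg
  have h2 : inftyValuation W f ≤ 1 := by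
    rcases eq_or_ne f 0 with rfl | h0
    · simp
    · exact (h1 hf h0).le
  -- `f` minus its residue is algebraic of value less than 1. Nonzero algebraic elements have value
  -- 1, so the difference is zero.
  obtain ⟨a, ha⟩ := exists_inftyValuation_sub_lt_one W h2
  refine ⟨a, ?_⟩
  by_contra h
  exact ha.ne (h1 (hf.sub (isAlgebraic_algebraMap a)) (sub_ne_zero.mpr (Ne.symm h)))

lemma inftyPlace_mem_iff (f : FunField W) : f ∈ inftyPlace W ↔ inftyValuation W f ≤ 1 :=
  Iff.rfl

end EllipticFunctionField
end

/-! ### Endomorphisms of the function field as points over it. -/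

noncomputable section

namespace EllipticFunctionField

open WeierstrassCurve WeierstrassCurve.Affine Polynomial

variable {F : Type*} [Field F] (W : WeierstrassCurve F)

local notation "ι" => algebraMap F (FunField W)

/-! ### Homomorphisms from the function field -/

lemma equation_iff_funField {x y : FunField W} : (W.toAffine⁄(FunField W)).Equation x y ↔
    y ^ 2 + ι W.a₁ * x * y + ι W.a₃ * y = x ^ 3 + ι W.a₂ * x ^ 2 + ι W.a₄ * x + ι W.a₆ :=
  (W.toAffine⁄(FunField W)).equation_iff _ _

lemma algHom_ext {σ τ : FunField W →ₐ[F] FunField W} (hx : σ (xGen W) = τ (xGen W))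
    (hy : σ (yGen W) = τ (yGen W)) : σ = τ := by
  have h (f : W.toAffine.CoordinateRing) :
      σ (algebraMap _ (FunField W) f) = τ (algebraMap _ (FunField W) f) := by
    obtain ⟨p, q, -, hf⟩ := exists_algebraMap_eq W f
    rw [hf, map_add, map_mul, map_add, map_mul, ← aeval_algHom_apply, ← aeval_algHom_apply,
      ← aeval_algHom_apply, ← aeval_algHom_apply, hx, hy]
  refine AlgHom.ext fun f ↦ ?_
  obtain ⟨a, b, -, rfl⟩ := IsFractionRing.div_surjective (A := W.toAffine.CoordinateRing) f
  rw [map_div₀, map_div₀, h, h]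

lemma eval₂_polynomial {S : Type*} [CommRing S] (φ : F[X] →+* S) (y : S) :
    W.toAffine.polynomial.eval₂ φ y = y ^ 2 + (φ (C W.a₁) * φ X + φ (C W.a₃)) * y -
      (φ X ^ 3 + φ (C W.a₂) * φ X ^ 2 + φ (C W.a₄) * φ X + φ (C W.a₆)) := by
  simp [WeierstrassCurve.Affine.polynomial, eval₂_pow]

/-- A point of `W` over its function field with transcendental `x`-coordinate is the image of the
generic point under an endomorphism of the function field. -/
lemma exists_algHom {x y : FunField W} (h : (W.toAffine⁄(FunField W)).Equation x y)
    (hx : Transcendental F x) :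
    ∃ σ : FunField W →ₐ[F] FunField W, σ (xGen W) = x ∧ σ (yGen W) = y := by
  have heq := (equation_iff_funField W).mp h
  have h0 : W.toAffine.polynomial.eval₂ (aeval x : F[X] →ₐ[F] FunField W) y = 0 := by
    rw [eval₂_polynomial]
    simp only [RingHom.coe_coe, aeval_X, aeval_C]
    linear_combination heq
  let g : W.toAffine.CoordinateRing →ₐ[F] FunField W :=
    AdjoinRoot.liftAlgHom W.toAffine.polynomial (aeval x) y h0
  have hgC (p : F[X]) : g (CoordinateRing.mk W (C p)) = aeval x p := AdjoinRoot.lift_of h0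
  have hgX : g (CoordinateRing.mk W X) = y := AdjoinRoot.lift_root h0
  have hinj : Function.Injective g := by
    rw [injective_iff_map_eq_zero]
    intro f hf
    by_contra hf0
    -- The norm of `f` is `f` times its conjugate, so `g` kills it too; but it is a nonzero
    -- polynomial in `x`, whose image is transcendental.
    have hdvd : g (CoordinateRing.mk W (C (Algebra.norm F[X] f))) = 0 := by
      obtain ⟨p, q, rfl⟩ := CoordinateRing.exists_smul_basis_eq f
      rw [CoordinateRing.smul, CoordinateRing.smul, mul_one, map_add, map_mul, hgC, hgC, hgX] at hf
      rw [hgC, CoordinateRing.norm_smul_basis]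
      simp only [map_add, map_sub, map_mul, map_pow, aeval_X, aeval_C]
      linear_combination (aeval x p - aeval x q * y - aeval x q * (ι W.a₁ * x + ι W.a₃)) * hf +
        aeval x q ^ 2 * heq
    rw [hgC] at hdvd
    exact norm_ne_zero W hf0 (transcendental_iff.mp hx _ hdvd)
  refine ⟨IsFractionRing.liftAlgHom hinj, ?_, ?_⟩
  · rw [IsFractionRing.liftAlgHom_apply, xGen, IsFractionRing.lift_algebraMap]
    exact (hgC X).trans (aeval_X x)
  · rw [IsFractionRing.liftAlgHom_apply, yGen, IsFractionRing.lift_algebraMap]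
    exact hgX

variable [W.IsElliptic]

lemma nonsingular_of_equation {x y : FunField W} (h : (W.toAffine⁄(FunField W)).Equation x y) :
    (W.toAffine⁄(FunField W)).Nonsingular x y :=
  equation_iff_nonsingular.mp h

open Classical in
lemma map_genericPoint (σ : FunField W →ₐ[F] FunField W) :
    ∃ h, Point.map (W' := W.toAffine) σ (genericPoint W) =
      .some (σ (xGen W)) (σ (yGen W)) h :=
  ⟨_, rfl⟩

open Classical in
-- This is the basic device: the image of `η` encodes the endomorphism, so composition can be
-- studied through the group law.
lemma map_genericPoint_injective {σ τ : FunField W →ₐ[F] FunField W}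
    (h : Point.map (W' := W.toAffine) σ (genericPoint W) =
      Point.map (W' := W.toAffine) τ (genericPoint W)) : σ = τ := by
  obtain ⟨_, h1⟩ := map_genericPoint W σ
  obtain ⟨_, h2⟩ := map_genericPoint W τ
  rw [h1, h2, Point.some.injEq] at h
  exact algHom_ext W h.1 h.2

omit [W.IsElliptic] in
open Classical in
-- If `x` is algebraic, then so is `y`, being a root of a monic quadratic. Both are then constants,
-- since `F` is algebraically closed in `E`.
lemma transcendental_of_notMem_range {x y : FunField W}
    {h : (W.toAffine⁄(FunField W)).Nonsingular x y}
    (hP : ∀ Q, Point.baseChange (W' := W.toAffine) F (FunField W) Q ≠ .some x y h) :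
    Transcendental F x := by
  intro hx
  obtain ⟨a, rfl⟩ := exists_algebraMap_eq_of_isAlgebraic W hx
  have heq := (equation_iff_funField W).mp h.1
  have hy : IsAlgebraic F y := by
    refine ⟨X ^ 2 + C (W.a₁ * a + W.a₃) * X - C (a ^ 3 + W.a₂ * a ^ 2 + W.a₄ * a + W.a₆), ?_, ?_⟩
    · refine Monic.ne_zero ?_
      monicity!
    · simp only [map_add, map_sub, map_mul, map_pow, aeval_X, aeval_C]
      linear_combination heq
  obtain ⟨b, rfl⟩ := exists_algebraMap_eq_of_isAlgebraic W hy
  have hab : (W.toAffine⁄F).Nonsingular a b :=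
    (W.toAffine.baseChange_nonsingular (Algebra.ofId F (FunField W)).injective a b).mp h
  exact hP (.some a b hab) rfl

open Classical in
lemma genericPoint_ne_baseChange (Q : (W.toAffine⁄F).Point) :
    Point.baseChange (W' := W.toAffine) F (FunField W) Q ≠ genericPoint W := by
  rcases Q with _ | ⟨a, b, h⟩
  · exact (Point.some_ne_zero _).symm
  · intro h'
    have hx : ι a = xGen W := (Point.some.inj h').1
    have h1 := one_lt_inftyValuation_xGen W
    rw [← hx] at h1
    exact h1.not_ge (map_algebraMap_le_one _ a)

open Classical in
lemma exists_algHom_map_genericPoint {P : (W.toAffine⁄(FunField W)).Point}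
    (hP : ∀ Q, Point.baseChange (W' := W.toAffine) F (FunField W) Q ≠ P) :
    ∃ σ : FunField W →ₐ[F] FunField W, Point.map (W' := W.toAffine) σ (genericPoint W) = P := by
  rcases P with _ | ⟨x, y, h⟩
  · exact absurd rfl (hP 0)
  · obtain ⟨σ, hx, hy⟩ := exists_algHom W h.1 (transcendental_of_notMem_range W hP)
    refine ⟨σ, ?_⟩
    obtain ⟨_, h1⟩ := map_genericPoint W σ
    rw [h1, Point.some.injEq]
    exact ⟨hx, hy⟩

/-! ### Existence of translations -/

open Classical in
-- `η - Q` is not constant, hence is the image of `η` under an endomorphism. The endomorphisms for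
-- `Q` and `-Q` are mutually inverse because constant points are fixed by every endomorphism.
lemma exists_isTranslationBy (Q : (W.toAffine⁄F).Point) : ∃ σ, IsTranslationBy W σ Q := by
  have h (Q : (W.toAffine⁄F).Point) : ∃ σ : FunField W →ₐ[F] FunField W,
      Point.map (W' := W.toAffine) σ (genericPoint W) =
        genericPoint W - Point.baseChange F (FunField W) Q := by
    refine exists_algHom_map_genericPoint W fun R hR ↦ genericPoint_ne_baseChange W (R + Q) ?_
    rw [map_add, hR, sub_add_cancel]
  have hcomp {Q : (W.toAffine⁄F).Point} {σ τ : FunField W →ₐ[F] FunField W}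
      (hσ : Point.map (W' := W.toAffine) σ (genericPoint W) =
        genericPoint W - Point.baseChange F (FunField W) Q)
      (hτ : Point.map (W' := W.toAffine) τ (genericPoint W) =
        genericPoint W - Point.baseChange F (FunField W) (-Q)) :
      σ.comp τ = AlgHom.id F _ := by
    apply map_genericPoint_injective W
    rw [← Point.map_map, hτ, map_sub, hσ, Point.map_baseChange, map_neg, sub_sub, add_neg_cancel,
      sub_zero]
    rfl
  obtain ⟨σ, hσ⟩ := h Q
  obtain ⟨τ, hτ⟩ := h (-Q)
  exact ⟨AlgEquiv.ofAlgHom σ τ (hcomp hσ hτ) (hcomp hτ (by rw [neg_neg]; exact hσ)), hσ⟩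

open Classical in
lemma aut_ext {σ τ : Aut W}
    (h : Point.map σ.toAlgHom (genericPoint W) = Point.map τ.toAlgHom (genericPoint W)) :
    σ = τ := by
  have := map_genericPoint_injective W h
  exact AlgEquiv.ext fun f ↦ DFunLike.congr_fun this f

open Classical in
lemma translationGroup_comm {σ τ : Aut W} (hσ : σ ∈ translationGroup W)
    (hτ : τ ∈ translationGroup W) : σ * τ = τ * σ := by
  obtain ⟨P, hP⟩ := hσ
  obtain ⟨Q, hQ⟩ := hτ
  rw [IsTranslationBy] at hP hQ
  apply aut_ext
  rw [map_mul_point, map_mul_point, hQ, map_sub, hP, map_sub, hQ, Point.map_baseChange,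
    Point.map_baseChange, sub_right_comm]

open Classical in
instance [Finite F] : Finite (translationGroup W) := by
  have hinj : Function.Injective fun σ : translationGroup W ↦ σ.2.choose := by
    intro σ τ h
    have hσ : IsTranslationBy W _ _ := σ.2.choose_spec
    have hτ : IsTranslationBy W _ _ := τ.2.choose_spec
    simp only at h
    rw [h] at hσ
    exact Subtype.ext (aut_ext W (hσ.trans hτ.symm))
  have : Finite (W.toAffine⁄F).Point := by
    refine Finite.of_injective (β := Option (F × F))
      (fun P ↦ match P with
        | .zero => none
        | .some x y _ => Option.some (x, y)) ?_
    rintro (_ | ⟨x, y, h⟩) (_ | ⟨x', y', h'⟩) hPQ <;> simp_all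
  exact Finite.of_injective _ hinj

/-! ### The stabilizer of the infinite place -/

instance (σ : FunField W →ₐ[F] FunField W) :
    ((inftyValuation W).comap (σ : FunField W →+* FunField W)).IsTrivialOn F where
  eq_one a ha := by
    rw [Valuation.comap_apply, RingHom.coe_coe, AlgHom.commutes]
    exact Valuation.IsTrivialOn.eq_one a ha

omit [W.IsElliptic] in
lemma mem_autO_iff_forall {σ : Aut W} :
    σ ∈ autO W ↔ ∀ f, inftyValuation W (σ f) ≤ 1 ↔ inftyValuation W f ≤ 1 := by
  -- Membership in `σ⁻¹ • O` is a condition on `σ f`, which is why the inverse is taken.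
  rw [← inv_mem_iff, autO, MulAction.mem_stabilizer_iff, ValuationSubring.ext_iff]
  refine forall_congr' fun f ↦ ?_
  rw [ValuationSubring.mem_inv_pointwise_smul_iff, inftyPlace_mem_iff, inftyPlace_mem_iff,
    AlgEquiv.smul_def]

omit [W.IsElliptic] in
-- Pulling `O` back along `σ` gives a place, and `O` is the only one with a pole at `x`.
lemma mem_autO_iff {σ : Aut W} : σ ∈ autO W ↔ 1 < inftyValuation W (σ (xGen W)) := by
  rw [mem_autO_iff_forall]
  refine ⟨fun h ↦ ?_, fun h f ↦ ?_⟩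
  · rw [← not_le, h, not_le]
    exact one_lt_inftyValuation_xGen W
  · exact (le_one_iff_le_one (inftyValuation W) (one_lt_inftyValuation_xGen W)
      ((inftyValuation W).comap (σ.toAlgHom : FunField W →+* FunField W)) h f).symm

end EllipticFunctionField
end

/-! ### The decomposition of `Aut(E/F)` into translations and the stabilizer of `O`. -/

noncomputable section

namespace EllipticFunctionField

open WeierstrassCurve WeierstrassCurve.Affine Polynomial

variable {F : Type*} [Field F] (W : WeierstrassCurve F) [W.IsElliptic]

local notation "ι" => algebraMap F (FunField W)

/-! ### Reduction at the infinite place -/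

open Classical in
omit [W.IsElliptic] in
-- The slope enters through its defining equation, without division, so that the addition law can be
-- applied by polynomial identities.
lemma some_add_some {x₁ y₁ x₂ y₂ : FunField W}
    (h₁ : (W.toAffine⁄(FunField W)).Nonsingular x₁ y₁)
    (h₂ : (W.toAffine⁄(FunField W)).Nonsingular x₂ y₂) (hx : x₁ ≠ x₂) {ℓ x₃ y₃ : FunField W}
    (hℓ : ℓ * (x₁ - x₂) = y₁ - y₂) (hx₃ : x₃ = ℓ ^ 2 + ι W.a₁ * ℓ - ι W.a₂ - x₁ - x₂)
    (hy₃ : y₃ = -(ℓ * (x₃ - x₁) + y₁) - ι W.a₁ * x₃ - ι W.a₃) :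
    ∃ h₃ : (W.toAffine⁄(FunField W)).Nonsingular x₃ y₃,
      Point.some x₁ y₁ h₁ + Point.some x₂ y₂ h₂ = Point.some x₃ y₃ h₃ := by
  have hs : (W.toAffine⁄(FunField W)).slope x₁ x₂ y₁ y₂ = ℓ := by
    rw [slope_of_X_ne hx, div_eq_iff (sub_ne_zero.mpr hx), hℓ]
  have hX : (W.toAffine⁄(FunField W)).addX x₁ x₂ ℓ = x₃ := hx₃.symm
  have hY : (W.toAffine⁄(FunField W)).addY x₁ x₂ y₁ ℓ = y₃ := by
    rw [addY, negAddY, hX, hy₃]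
    rfl
  have h := nonsingular_add h₁ h₂ fun hxy ↦ hx hxy.left
  have h' := Point.add_of_X_ne (h₁ := h₁) (h₂ := h₂) hx
  simp only [hs, hX, hY] at h h'
  exact ⟨h, h'⟩

open Classical in
omit [W.IsElliptic] in
lemma some_sub_baseChange_some {x y : FunField W} {a b : F}
    (h : (W.toAffine⁄(FunField W)).Nonsingular x y) (hQ : (W.toAffine⁄F).Nonsingular a b)
    (hx : x ≠ ι a) {ℓ x₃ y₃ : FunField W}
    (hℓ : ℓ * (x - ι a) = y + ι b + ι W.a₁ * ι a + ι W.a₃)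
    (hx₃ : x₃ = ℓ ^ 2 + ι W.a₁ * ℓ - ι W.a₂ - x - ι a)
    (hy₃ : y₃ = -(ℓ * (x₃ - x) + y) - ι W.a₁ * x₃ - ι W.a₃) :
    ∃ h₃ : (W.toAffine⁄(FunField W)).Nonsingular x₃ y₃,
      Point.some x y h - Point.baseChange F (FunField W) (.some a b hQ) = Point.some x₃ y₃ h₃ := by
  have h₂ : (W.toAffine⁄(FunField W)).Nonsingular (ι a) (ι b) :=
    (W.toAffine.baseChange_nonsingular (Algebra.ofId F (FunField W)).injective a b).mpr hQ
  have h₂' := (nonsingular_neg ..).mpr h₂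
  have hneg : -Point.baseChange F (FunField W) (.some a b hQ) = .some _ _ h₂' := rfl
  rw [sub_eq_add_neg, hneg]
  refine some_add_some W h h₂' hx (hℓ.trans ?_) hx₃ hy₃
  have : (W.toAffine⁄(FunField W)).negY (ι a) (ι b) = -ι b - ι W.a₁ * ι a - ι W.a₃ := rfl
  rw [this]
  ring

local notation "v" => inftyValuation W

omit [W.IsElliptic] in
lemma inftyValuation_eq_one_of_sub_lt_one {f : FunField W} {c : F} (hc : c ≠ 0)
    (h : v (f - ι c) < 1) : v f = 1 := by
  have h1 : v (ι c) = 1 := Valuation.IsTrivialOn.eq_one c hc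
  rw [← sub_add_cancel f (ι c), (inftyValuation W).map_add_eq_of_lt_right (h.trans_eq h1.symm), h1]

omit [W.IsElliptic] in
lemma inftyValuation_mul_lt_one {f g : FunField W} (hf : v f < 1) (hg : g ∈ inftyPlace W) :
    v (f * g) < 1 := by
  rw [map_mul]
  exact mul_lt_one_of_lt_of_le hf hg

omit [W.IsElliptic] in
lemma algebraMap_mem_inftyPlace (a : F) : ι a ∈ inftyPlace W :=
  (inftyPlace_mem_iff W _).mpr (map_algebraMap_le_one _ a)

open Classical in
/-- A point of `W` over its function field that is not constant reduces at infinity to a rational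
point. -/
lemma exists_sub_baseChange_pole {P : (W.toAffine⁄(FunField W)).Point}
    (hP : ∀ Q, Point.baseChange (W' := W.toAffine) F (FunField W) Q ≠ P) :
    ∃ Q x y h, P - Point.baseChange (W' := W.toAffine) F (FunField W) Q = .some x y h ∧
      1 < v x := by
  rcases P with _ | ⟨x, y, h⟩
  · exact absurd rfl (hP 0)
  rcases lt_or_ge 1 (v x) with hx1 | hx1
  · exact ⟨0, x, y, h, by rw [map_zero, sub_zero], hx1⟩
  have heq := (equation_iff_funField W).mp h.1
  have hι := algebraMap_mem_inftyPlace W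
  have hxO : x ∈ inftyPlace W := (inftyPlace_mem_iff W x).mpr hx1
  have hyO : y ∈ inftyPlace W := by
    by_contra hy
    have hy' : 1 < v y := by rwa [inftyPlace_mem_iff, not_le] at hy
    have h1 : ι W.a₁ * x + ι W.a₃ ∈ inftyPlace W := add_mem (mul_mem (hι _) hxO) (hι _)
    have h2 : y * (y + (ι W.a₁ * x + ι W.a₃)) ∈ inftyPlace W := by
      have : y * (y + (ι W.a₁ * x + ι W.a₃)) =
          x ^ 3 + ι W.a₂ * x ^ 2 + ι W.a₄ * x + ι W.a₆ := by linear_combination heq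
      rw [this]
      exact add_mem (add_mem (add_mem (pow_mem hxO 3) (mul_mem (hι _) (pow_mem hxO 2)))
        (mul_mem (hι _) hxO)) (hι _)
    have h3 : v (y + (ι W.a₁ * x + ι W.a₃)) = v y :=
      (inftyValuation W).map_add_eq_of_lt_left (lt_of_le_of_lt ((inftyPlace_mem_iff W _).mp h1) hy')
    rw [inftyPlace_mem_iff, map_mul, h3] at h2
    exact h2.not_gt (one_lt_mul_of_lt_of_le' hy' hy'.le)
  obtain ⟨a, ha⟩ := exists_inftyValuation_sub_lt_one W hx1
  obtain ⟨b, hb⟩ := exists_inftyValuation_sub_lt_one W hyO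
  -- The Weierstrass equation is reduced modulo the maximal ideal at infinity: a constant of value
  -- less than 1 is zero.
  have hE : b ^ 2 + W.a₁ * a * b + W.a₃ * b = a ^ 3 + W.a₂ * a ^ 2 + W.a₄ * a + W.a₆ := by
    by_contra hne
    have h1 : v (ι (b ^ 2 + W.a₁ * a * b + W.a₃ * b - (a ^ 3 + W.a₂ * a ^ 2 + W.a₄ * a + W.a₆))) =
        1 := Valuation.IsTrivialOn.eq_one _ (sub_ne_zero.mpr hne)
    refine h1.not_lt ?_
    have h2 : ι (b ^ 2 + W.a₁ * a * b + W.a₃ * b - (a ^ 3 + W.a₂ * a ^ 2 + W.a₄ * a + W.a₆)) =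
        (y - ι b) * (-(y + ι b + ι W.a₁ * x + ι W.a₃)) + (x - ι a) *
          (x ^ 2 + x * ι a + ι a ^ 2 + ι W.a₂ * (x + ι a) + ι W.a₄ - ι W.a₁ * ι b) := by
      simp only [map_sub, map_add, map_mul, map_pow]
      linear_combination heq
    rw [h2]
    refine (inftyValuation W).map_add_lt ?_ ?_
    · apply inftyValuation_mul_lt_one W hb
      exact neg_mem (add_mem (add_mem (add_mem hyO (hι _)) (mul_mem (hι _) hxO)) (hι _))
    · apply inftyValuation_mul_lt_one W ha
      exact sub_mem (add_mem (add_mem (add_mem (add_mem (pow_mem hxO 2) (mul_mem hxO (hι _)))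
        (pow_mem (hι _) 2)) (mul_mem (hι _) (add_mem hxO (hι _)))) (hι _)) (mul_mem (hι _) (hι _))
  have hQ : (W.toAffine⁄F).Nonsingular a b := equation_iff_nonsingular (W := W).mp
    ((W.toAffine.equation_iff a b).mpr hE)
  have hxa : x ≠ ι a := by
    rintro rfl
    exact transcendental_of_notMem_range W hP (isAlgebraic_algebraMap a)
  have hm : x - ι a ≠ 0 := sub_ne_zero.mpr hxa
  set N := y + ι b + ι W.a₁ * ι a + ι W.a₃ with hN
  obtain ⟨h₃, hadd⟩ := some_sub_baseChange_some W h hQ hxa (ℓ := N / (x - ι a))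
    (div_mul_cancel₀ _ hm) rfl rfl
  refine ⟨_, _, _, h₃, hadd, ?_⟩
  have hℓ : 1 < v (N / (x - ι a)) := by
    have hm0 : v (x - ι a) ≠ 0 := (Valuation.ne_zero_iff _).mpr hm
    -- Otherwise the numerator of the slope reduces to a nonzero constant while `x - a` vanishes at
    -- `O`. If `Q = -Q`, the slope is rewritten with denominator `y - b`; its numerator then reduces
    -- to the other partial derivative, which is nonzero by nonsingularity.
    by_cases hc : 2 * b + W.a₁ * a + W.a₃ = 0
    · have hd : 3 * a ^ 2 + 2 * W.a₂ * a + W.a₄ - W.a₁ * b ≠ 0 := by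
        intro hd
        rcases ((W.toAffine.nonsingular_iff' a b).mp hQ).2 with h1 | h1
        · exact h1 (by linear_combination -hd)
        · exact h1 hc
      have hD : v (x ^ 2 + x * ι a + ι a ^ 2 + ι W.a₂ * (x + ι a) + ι W.a₄ - ι W.a₁ * y) = 1 := by
        refine inftyValuation_eq_one_of_sub_lt_one W hd ?_
        have : x ^ 2 + x * ι a + ι a ^ 2 + ι W.a₂ * (x + ι a) + ι W.a₄ - ι W.a₁ * y -
            ι (3 * a ^ 2 + 2 * W.a₂ * a + W.a₄ - W.a₁ * b) =
            (x - ι a) * (x + 2 * ι a + ι W.a₂) + (y - ι b) * (-ι W.a₁) := by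
          simp only [map_sub, map_add, map_mul, map_pow, map_ofNat]
          ring
        rw [this]
        refine (inftyValuation W).map_add_lt ?_ ?_
        · apply inftyValuation_mul_lt_one W ha
          rw [two_mul]
          exact add_mem (add_mem hxO (add_mem (hι _) (hι _))) (hι _)
        · apply inftyValuation_mul_lt_one W hb
          exact neg_mem (hι _)
      have hnD : (y - ι b) * (N / (x - ι a)) =
          x ^ 2 + x * ι a + ι a ^ 2 + ι W.a₂ * (x + ι a) + ι W.a₄ - ι W.a₁ * y := by
        have hE' := congr_arg ι hE
        simp only [map_add, map_mul, map_pow] at hE'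
        rw [← mul_div_assoc, div_eq_iff hm, hN]
        linear_combination heq - hE'
      rw [← hnD, map_mul] at hD
      by_contra! hle
      exact (mul_lt_one_of_lt_of_le hb hle).ne hD
    · have hN1 : v N = 1 := by
        refine inftyValuation_eq_one_of_sub_lt_one W hc ?_
        have : N - ι (2 * b + W.a₁ * a + W.a₃) = y - ι b := by
          rw [hN]
          simp only [map_add, map_mul, map_ofNat]
          ring
        rwa [this]
      rw [map_div₀, hN1, one_div]
      exact (one_lt_inv₀ (zero_lt_iff.mpr hm0)).mpr ha
  set ℓ := N / (x - ι a)
  -- Since `ℓ` has a pole, `ℓ²` dominates the new `x`-coordinate.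
  have h1 : ℓ ^ 2 + ι W.a₁ * ℓ - ι W.a₂ - x - ι a = ℓ ^ 2 + (ι W.a₁ * ℓ - (ι W.a₂ + x + ι a)) := by
    ring
  have h2 : v ℓ < v (ℓ ^ 2) := by
    rw [map_pow, sq]
    exact lt_mul_of_one_lt_left (zero_lt_one.trans hℓ) hℓ
  have h3 : v (ι W.a₁ * ℓ - (ι W.a₂ + x + ι a)) ≤ v ℓ := by
    refine (inftyValuation W).map_sub_le ?_ ?_
    · rw [map_mul]
      exact mul_le_of_le_one_left' (map_algebraMap_le_one _ _)
    · refine le_trans ?_ hℓ.le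
      exact (inftyPlace_mem_iff W _).mp (add_mem (add_mem (hι _) hxO) (hι _))
  rw [h1, (inftyValuation W).map_add_eq_of_lt_left (h3.trans_lt h2)]
  exact hℓ.trans h2

/-! ### The decomposition of an automorphism -/

open Classical in
-- Let `Q` be the reduction at `O` of `σ⁻¹η`. Then `σ⁻¹ τ_Q` sends `η` to `σ⁻¹η - Q`, whose
-- `x`-coordinate has a pole at `O`, so `σ⁻¹ τ_Q` fixes `O`.
lemma exists_translation_mul_autO (σ : Aut W) :
    ∃ τ ∈ translationGroup W, ∃ ρ ∈ autO W, σ = τ * ρ := by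
  have hP : ∀ Q, Point.baseChange (W' := W.toAffine) F (FunField W) Q ≠
      Point.map (σ⁻¹).toAlgHom (genericPoint W) := by
    intro Q hQ
    refine genericPoint_ne_baseChange W Q ?_
    have h := congr_arg (Point.map σ.toAlgHom) hQ
    rwa [← map_mul_point, mul_inv_cancel, map_one_point, Point.map_baseChange] at h
  obtain ⟨Q, x, y, h, hxy, hx⟩ := exists_sub_baseChange_pole W hP
  obtain ⟨τ, hτ⟩ := exists_isTranslationBy W Q
  refine ⟨τ, ⟨Q, hτ⟩, (σ⁻¹ * τ)⁻¹, inv_mem (mem_autO_iff W |>.mpr ?_), by group⟩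
  have h1 : Point.map (σ⁻¹ * τ).toAlgHom (genericPoint W) = .some x y h := by
    rw [map_mul_point, hτ, map_sub, Point.map_baseChange, hxy]
  obtain ⟨_, h2⟩ := map_genericPoint W (σ⁻¹ * τ).toAlgHom
  rw [h2, Point.some.injEq] at h1
  rw [← h1.1] at hx
  exact hx

open Classical in
lemma eq_one_of_mem_translationGroup_of_mem_autO {σ : Aut W} (hσ : σ ∈ translationGroup W)
    (hσO : σ ∈ autO W) : σ = 1 := by
  obtain ⟨Q, hQ⟩ := hσ
  rw [mem_autO_iff] at hσO
  apply aut_ext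
  rw [IsTranslationBy] at hQ
  rcases Q with _ | ⟨a, b, hab⟩
  · rw [hQ, map_one_point]
    exact sub_zero _
  · exfalso
    have hxa : xGen W ≠ ι a := by
      intro hx
      have h1 := one_lt_inftyValuation_xGen W
      rw [hx] at h1
      exact h1.not_ge (map_algebraMap_le_one _ a)
    have hm : xGen W - ι a ≠ 0 := sub_ne_zero.mpr hxa
    set N := yGen W + ι b + ι W.a₁ * ι a + ι W.a₃ with hN
    obtain ⟨h₃, hadd⟩ := some_sub_baseChange_some W
      (nonsingular_of_equation W (equation_gen W)) hab hxa (ℓ := N / (xGen W - ι a))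
      (div_mul_cancel₀ _ hm) rfl rfl
    obtain ⟨_, h2⟩ := map_genericPoint W σ.toAlgHom
    have h3 := h2.symm.trans (hQ.trans hadd)
    rw [Point.some.injEq] at h3
    have h4 : σ (xGen W) = (N / (xGen W - ι a)) ^ 2 + ι W.a₁ * (N / (xGen W - ι a)) - ι W.a₂ -
        xGen W - ι a := h3.1
    -- Clearing denominators in the addition formula and using the curve equation cancels the cubic
    -- terms. What remains has a pole of order at most 4, that of `(x - a)²`, so the `x`-coordinate
    -- of `η - Q` is regular at `O`.
    have h5 : σ (xGen W) * (xGen W - ι a) ^ 2 = ι a * xGen W ^ 2 +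
        ι (W.a₄ + 2 * a * W.a₂ + a ^ 2 + W.a₁ * (b + W.a₁ * a + W.a₃)) * xGen W +
        ι (2 * b + W.a₁ * a + W.a₃) * yGen W +
        ι (W.a₆ + (b + W.a₁ * a + W.a₃) ^ 2 - W.a₁ * a * (b + W.a₁ * a + W.a₃) -
          (W.a₂ + a) * a ^ 2) := by
      have : σ (xGen W) * (xGen W - ι a) ^ 2 = N ^ 2 + ι W.a₁ * N * (xGen W - ι a) -
          (ι W.a₂ + xGen W + ι a) * (xGen W - ι a) ^ 2 := by
        rw [h4]
        field_simp
        ring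
      rw [this, hN]
      simp only [map_sub, map_add, map_mul, map_pow, map_ofNat]
      linear_combination gen_relation W
    have hvx : v (xGen W - ι a) = WithZero.exp 2 := by
      rw [← inftyValuation_xGen W]
      exact (inftyValuation W).map_sub_eq_of_lt_left
        ((map_algebraMap_le_one _ a).trans_lt (one_lt_inftyValuation_xGen W))
    have h6 : v (σ (xGen W) * (xGen W - ι a) ^ 2) ≤ WithZero.exp 2 ^ 2 := by
      rw [h5]
      have hle (c : F) {f : FunField W} (hf : v f ≤ WithZero.exp 2 ^ 2) :
          v (ι c * f) ≤ WithZero.exp 2 ^ 2 := by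
        rw [map_mul]
        exact (mul_le_of_le_one_left' (map_algebraMap_le_one _ c)).trans hf
      have h2 : (WithZero.exp 2 ^ 2 : ℤᵐ⁰) = WithZero.exp 4 := by
        rw [← WithZero.exp_nsmul]; rfl
      refine (inftyValuation W).map_add_le ((inftyValuation W).map_add_le
        ((inftyValuation W).map_add_le (hle _ ?_) (hle _ ?_)) (hle _ ?_)) ?_
      · rw [map_pow, inftyValuation_xGen]
      · rw [inftyValuation_xGen, h2, WithZero.exp_le_exp]
        norm_num
      · rw [inftyValuation_yGen, h2, WithZero.exp_le_exp]
        norm_num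
      · refine (map_algebraMap_le_one _ _).trans ?_
        rw [h2, ← WithZero.exp_zero, WithZero.exp_le_exp]
        norm_num
    rw [map_mul, map_pow, hvx] at h6
    refine hσO.not_ge ?_
    have hpos : (0 : ℤᵐ⁰) < WithZero.exp 2 ^ 2 := pow_pos (zero_lt_iff.mpr WithZero.exp_ne_zero) 2
    exact le_of_mul_le_mul_right (h6.trans_eq (one_mul _).symm) hpos

end EllipticFunctionField
end

/-! ### Elements of `Aut(E, O)` are admissible changes of variables. -/

noncomputable section

namespace EllipticFunctionField

open WeierstrassCurve WeierstrassCurve.Affine Polynomial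

variable {F : Type*} [Field F] (W : WeierstrassCurve F)

local notation "ι" => algebraMap F (FunField W)

/-! ### The affine coordinate ring is integrally closed -/

lemma algebraMap_polynomial (p : F[X]) : algebraMap F[X] (FunField W) p = aeval (xGen W) p := by
  rw [← algebraMap_mk_C]
  rfl

lemma transcendental_xGen : Transcendental F (xGen W) := by
  rw [transcendental_iff]
  intro p hp
  exact (aeval_add_aeval_mul_eq_zero W (q := 0) (by rw [hp, map_zero, zero_mul, add_zero])).1

lemma aeval_xGen_ne_zero {p : F[X]} (hp : p ≠ 0) : aeval (xGen W) p ≠ 0 :=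
  fun h ↦ hp (transcendental_iff.mp (transcendental_xGen W) p h)

lemma dvd_of_isIntegral_div {p d : F[X]} (hd : d ≠ 0)
    (h : IsIntegral F[X] (aeval (xGen W) p / aeval (xGen W) d)) : d ∣ p := by
  have hinj : Function.Injective (Algebra.ofId F[X] (FunField W)) := by
    rw [injective_iff_map_eq_zero]
    intro f hf
    by_contra hf0
    exact aeval_xGen_ne_zero W hf0 (by rw [← algebraMap_polynomial]; exact hf)
  let j : FractionRing F[X] →ₐ[F[X]] FunField W := IsFractionRing.liftAlgHom hinj
  have hj (f : F[X]) : j (algebraMap _ _ f) = aeval (xGen W) f := by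
    rw [AlgHom.commutes, algebraMap_polynomial]
  rw [← hj, ← hj, ← map_div₀, isIntegral_algHom_iff j (j : FractionRing F[X] →+* FunField W).injective,
    IsIntegrallyClosed.isIntegral_iff] at h
  obtain ⟨y, hy⟩ := h
  have hd' : algebraMap F[X] (FractionRing F[X]) d ≠ 0 :=
    (FaithfulSMul.algebraMap_eq_zero_iff _ _).not.mpr hd
  rw [eq_div_iff hd', ← map_mul] at hy
  exact ⟨y, by rw [mul_comm, FaithfulSMul.algebraMap_injective _ _ hy]⟩

/-- This is negation on the curve, used to form traces and norms down to `F(x)`. -/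
lemma exists_conj : ∃ ν : FunField W →ₐ[F[X]] FunField W,
    ν (yGen W) = -yGen W - (ι W.a₁ * xGen W + ι W.a₃) := by
  obtain ⟨ν, hx, hy⟩ := exists_algHom W (x := xGen W)
    (y := -yGen W - (ι W.a₁ * xGen W + ι W.a₃)) (by
      rw [equation_iff_funField]
      linear_combination gen_relation W) (transcendental_xGen W)
  refine ⟨{ ν with commutes' := fun p ↦ ?_ }, hy⟩
  change ν (algebraMap F[X] (FunField W) p) = _
  rw [algebraMap_polynomial, ← aeval_algHom_apply, hx]

variable [W.IsElliptic]

/-- At a prime of `F[x]` at which this fails, the curve would have a singular point with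
coordinates in the residue field. -/
lemma dvd_of_dvd_trace_of_sq_dvd_norm {π p q : F[X]} (hπ : Prime π)
    (htr : π ∣ 2 * p - q * (C W.a₁ * X + C W.a₃))
    (hnm : π ^ 2 ∣ p ^ 2 - p * q * (C W.a₁ * X + C W.a₃) -
      q ^ 2 * (X ^ 3 + C W.a₂ * X ^ 2 + C W.a₄ * X + C W.a₆)) : π ∣ p ∧ π ∣ q := by
  by_cases hq : π ∣ q
  · refine ⟨?_, hq⟩
    obtain ⟨k, rfl⟩ := hq
    refine hπ.dvd_of_dvd_pow (n := 2) ?_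
    obtain ⟨m, hm⟩ := hnm
    exact ⟨π * m + p * k * (C W.a₁ * X + C W.a₃) +
      π * k ^ 2 * (X ^ 3 + C W.a₂ * X ^ 2 + C W.a₄ * X + C W.a₆), by linear_combination hm⟩
  exfalso
  -- `q` is invertible modulo `π²` with inverse `e`, and `c = e * p` plays the role of `p / q`.
  have hcop : IsCoprime q (π ^ 2) :=
    IsCoprime.pow_right ((hπ.irreducible.coprime_iff_not_dvd.mpr hq).symm)
  obtain ⟨e, k, hek⟩ := hcop
  obtain ⟨m, hm⟩ := hnm
  obtain ⟨n, hn⟩ := htr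
  obtain ⟨h, hh⟩ : ∃ h : F[X], h = C W.a₁ * X + C W.a₃ := ⟨_, rfl⟩
  obtain ⟨g, hg⟩ : ∃ g : F[X], g = X ^ 3 + C W.a₂ * X ^ 2 + C W.a₄ * X + C W.a₆ := ⟨_, rfl⟩
  rw [← hh, ← hg] at hm
  rw [← hh] at hn
  obtain ⟨c, hc⟩ : ∃ c, c = e * p := ⟨_, rfl⟩
  have h1 : 2 * c - h = π * (e * n - k * π * h) := by
    rw [hc]; linear_combination e * hn + h * hek
  obtain ⟨M, h2⟩ : ∃ M, c ^ 2 - c * h - g = π ^ 2 * M :=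
    ⟨e ^ 2 * m - c * k * h - (2 - k * π ^ 2) * k * g, by
      rw [hc]; linear_combination e ^ 2 * hm + (e * p * h + g * (e * q + 1 - k * π ^ 2)) * hek⟩
  -- A multiple of `π²` has a derivative divisible by `π`, so `h2` can be differentiated. Modulo
  -- `π`, the three relations say that `(x, -c)` lies on the curve and both partial derivatives
  -- vanish there.
  have h3 : c * derivative h + derivative g =
      π * (derivative c * (e * n - k * π * h) - 2 * derivative π * M - π * derivative M) := by
    have := congr_arg derivative h2
    simp only [derivative_sub, derivative_mul, derivative_sq, C_ofNat] at this
    linear_combination derivative c * h1 - this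
  have hirr : Fact (Irreducible π) := ⟨hπ.irreducible⟩
  have hroot : aeval (AdjoinRoot.root π) π = 0 := by
    rw [AdjoinRoot.aeval_eq, AdjoinRoot.mk_self]
  let V := W.map (algebraMap F (AdjoinRoot π))
  have e1 := congr_arg (aeval (AdjoinRoot.root π)) h1
  have e2 := congr_arg (aeval (AdjoinRoot.root π)) h2
  have e3 := congr_arg (aeval (AdjoinRoot.root π)) h3
  have hdh : derivative h = C W.a₁ := by simp [hh]
  have hdg : derivative g = 3 * X ^ 2 + 2 * C W.a₂ * X + C W.a₄ := by
    simp only [hg, derivative_add, derivative_mul, derivative_C, derivative_X_pow, derivative_X,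
      C_ofNat, Nat.cast_ofNat]
    ring
  rw [hdh, hdg] at e3
  simp only [hh, hg, map_add, map_sub, map_mul, map_pow, aeval_X, aeval_C, hroot,
    map_ofNat, zero_mul, ne_eq, OfNat.ofNat_ne_zero, not_false_eq_true, zero_pow] at e1 e2 e3
  have heq : V.toAffine.Equation (AdjoinRoot.root π) (-aeval (AdjoinRoot.root π) c) := by
    rw [equation_iff']
    simp only [V, WeierstrassCurve.map_a₁, WeierstrassCurve.map_a₂, WeierstrassCurve.map_a₃,
      WeierstrassCurve.map_a₄, WeierstrassCurve.map_a₆]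
    linear_combination e2
  have hns := equation_iff_nonsingular.mp heq
  rw [nonsingular_iff'] at hns
  simp only [V, WeierstrassCurve.map_a₁, WeierstrassCurve.map_a₂, WeierstrassCurve.map_a₃,
    WeierstrassCurve.map_a₄] at hns
  rcases hns.2 with h | h
  · refine h ?_
    linear_combination -e3
  · refine h ?_
    linear_combination -e1

/-- The coordinate ring of an elliptic curve is integrally closed. -/
lemma exists_aeval_eq_of_isIntegral {f : FunField W} (hf : IsIntegral F[X] f) :
    ∃ p q : F[X], f = aeval (xGen W) p + aeval (xGen W) q * yGen W := by
  -- A denominator in `F[x]` is removed one prime factor at a time. Initially it is the norm of `b`,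
  -- a multiple of `b`.
  suffices h : ∀ d : F[X], d ≠ 0 → ∀ f : FunField W, IsIntegral F[X] f →
      (∃ p q : F[X], aeval (xGen W) d * f = aeval (xGen W) p + aeval (xGen W) q * yGen W) →
      ∃ p q : F[X], f = aeval (xGen W) p + aeval (xGen W) q * yGen W by
    obtain ⟨a, b, hb, rfl⟩ := IsFractionRing.div_surjective (A := W.toAffine.CoordinateRing) f
    have hb0 := nonZeroDivisors.ne_zero hb
    have hb1 : algebraMap _ (FunField W) b ≠ 0 :=
      (FaithfulSMul.algebraMap_eq_zero_iff _ _).not.mpr hb0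
    refine h (Algebra.norm F[X] b) (norm_ne_zero W hb0) _ hf ?_
    obtain ⟨c, hc⟩ : ∃ c, CoordinateRing.mk W (C (Algebra.norm F[X] b)) = b * c := by
      obtain ⟨p, q, rfl⟩ := CoordinateRing.exists_smul_basis_eq b
      refine ⟨CoordinateRing.mk W (C p + C q * (-X - C (C W.a₁ * X + C W.a₃))), ?_⟩
      have := CoordinateRing.coe_norm_smul_basis (W' := W.toAffine) p q
      rw [map_mul] at this
      refine this.trans ?_
      rw [CoordinateRing.smul, CoordinateRing.smul, mul_one, map_add (CoordinateRing.mk W) (C p),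
        map_mul]
    obtain ⟨p, q, -, hpq⟩ := exists_algebraMap_eq W (a * c)
    refine ⟨p, q, ?_⟩
    rw [← hpq, ← algebraMap_mk_C, hc, map_mul, map_mul]
    field_simp
  intro d
  refine UniqueFactorizationMonoid.induction_on_prime d (fun h ↦ absurd rfl h) ?_ ?_
  · rintro u hu - f - ⟨p, q, hpq⟩
    obtain ⟨e, he⟩ := hu.exists_left_inv
    refine ⟨e * p, e * q, ?_⟩
    have he' := congr_arg (aeval (xGen W)) he
    rw [map_mul, map_one] at he'
    rw [map_mul, map_mul]
    linear_combination aeval (xGen W) e * hpq - f * he'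
  · rintro d π hd hπ ih - f hf ⟨p, q, hpq⟩
    have hπ0 := aeval_xGen_ne_zero W hπ.ne_zero
    have hdf : IsIntegral F[X] (aeval (xGen W) d * f) := by
      rw [← algebraMap_polynomial]
      exact isIntegral_algebraMap.mul hf
    refine ih hd f hf ?_
    obtain ⟨g, hg⟩ : ∃ g, g = aeval (xGen W) d * f := ⟨_, rfl⟩
    rw [map_mul, mul_assoc, ← hg] at hpq
    rw [← hg] at hdf ⊢
    obtain ⟨ν, hν⟩ := exists_conj W
    have hνg : aeval (xGen W) π * ν g = aeval (xGen W) p +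
        aeval (xGen W) q * (-yGen W - (ι W.a₁ * xGen W + ι W.a₃)) := by
      have h1 := congr_arg ν hpq
      simp only [← algebraMap_polynomial, map_mul, map_add, AlgHom.commutes, hν] at h1
      simpa only [algebraMap_polynomial] using h1
    have hνint : IsIntegral F[X] (ν g) := hdf.map ν
    -- Trace and norm of `g` are integral elements of `F(x)`, hence polynomials. This gives
    -- divisibility by `π` and `π²` of their numerators, and so `π` divides `p` and `q`.
    have htr : g + ν g = aeval (xGen W) (2 * p - q * (C W.a₁ * X + C W.a₃)) /
        aeval (xGen W) π := by
      rw [eq_div_iff hπ0]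
      simp only [map_sub, map_add, map_mul, aeval_X, aeval_C, map_ofNat]
      linear_combination hpq + hνg
    have hnm : g * ν g = aeval (xGen W) (p ^ 2 - p * q * (C W.a₁ * X + C W.a₃) -
        q ^ 2 * (X ^ 3 + C W.a₂ * X ^ 2 + C W.a₄ * X + C W.a₆)) / aeval (xGen W) (π ^ 2) := by
      rw [eq_div_iff (by rw [map_pow]; exact pow_ne_zero 2 hπ0)]
      simp only [map_sub, map_add, map_mul, map_pow, aeval_X, aeval_C]
      linear_combination aeval (xGen W) π * ν g * hpq +
        (aeval (xGen W) p + aeval (xGen W) q * yGen W) * hνg -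
        aeval (xGen W) q ^ 2 * gen_relation W
    obtain ⟨⟨r, rfl⟩, ⟨s, rfl⟩⟩ := dvd_of_dvd_trace_of_sq_dvd_norm W hπ
      (dvd_of_isIntegral_div W hπ.ne_zero (htr ▸ hdf.add hνint))
      (dvd_of_isIntegral_div W (pow_ne_zero 2 hπ.ne_zero) (hnm ▸ hdf.mul hνint))
    refine ⟨r, s, mul_left_cancel₀ hπ0 ?_⟩
    rw [hpq, map_mul, map_mul]
    ring

/-! ### Automorphisms fixing the infinite place are linear -/

/-- A function is regular away from infinity if it belongs to every valuation ring of `E/F` that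
contains `x`. -/
lemma exists_aeval_eq_of_forall_mem {f : FunField W}
    (hf : ∀ V : ValuationSubring (FunField W), (∀ a : F, ι a ∈ V) → xGen W ∈ V → f ∈ V) :
    ∃ p q : F[X], f = aeval (xGen W) p + aeval (xGen W) q * yGen W := by
  apply exists_aeval_eq_of_isIntegral
  by_contra h
  have : IsIntegrallyClosedIn (integralClosure F[X] (FunField W)).toSubring (FunField W) :=
    inferInstanceAs (IsIntegrallyClosedIn (integralClosure F[X] (FunField W)) (FunField W))
  -- An integrally closed subring is the intersection of the valuation rings above it.
  obtain ⟨V, hV, hfV⟩ := Subring.exists_le_valuationSubring_of_isIntegrallyClosedIn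
    (R := (integralClosure F[X] (FunField W)).toSubring) (x := f) h
  have hmem (p : F[X]) : aeval (xGen W) p ∈ V := by
    rw [← algebraMap_polynomial]
    exact hV (isIntegral_algebraMap (x := p))
  refine hfV (hf V (fun a ↦ ?_) ?_)
  · simpa using hmem (C a)
  · simpa using hmem X

omit [W.IsElliptic] in
lemma isTrivialOn_valuation {V : ValuationSubring (FunField W)} (hV : ∀ a : F, ι a ∈ V) :
    V.valuation.IsTrivialOn F where
  eq_one a ha := by
    refine le_antisymm ((V.valuation_le_one_iff _).mpr (hV a)) ?_
    have := (V.valuation_le_one_iff _).mpr (hV a⁻¹)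
    rw [map_inv₀, map_inv₀] at this
    have h0 : V.valuation (ι a) ≠ 0 := (Valuation.ne_zero_iff _).mpr (by simpa using ha)
    exact (inv_le_one₀ (zero_lt_iff.mpr h0)).mp this

omit [W.IsElliptic] in
-- If `ρ x` had a pole at `V`, the pullback of `V` along `ρ` would be `O`. But `ρ⁻¹ x` has a pole at
-- `O`, while its pulled-back value is that of `x` at `V`, where `x` is finite.
lemma xGen_mem_comap {ρ : Aut W} (hρ : ρ ∈ autO W) {V : ValuationSubring (FunField W)}
    (hV : ∀ a : F, ι a ∈ V) (hx : xGen W ∈ V) : ρ (xGen W) ∈ V := by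
  by_contra h
  have := isTrivialOn_valuation W hV
  have : (V.valuation.comap (ρ.toAlgHom : FunField W →+* FunField W)).IsTrivialOn F := ⟨by
    intro a ha
    change V.valuation (ρ (ι a)) = 1
    rw [AlgEquiv.commutes]
    exact Valuation.IsTrivialOn.eq_one a ha⟩
  have h1 : 1 < (V.valuation.comap (ρ.toAlgHom : FunField W →+* FunField W)) (xGen W) := by
    rwa [← not_le, Valuation.comap_apply, V.valuation_le_one_iff]
  have h2 := le_one_iff_le_one (inftyValuation W) (one_lt_inftyValuation_xGen W) _ h1
    (ρ⁻¹ (xGen W))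
  have h3 : ρ (ρ⁻¹ (xGen W)) = xGen W := ρ.apply_symm_apply _
  have h4 : (V.valuation.comap (ρ.toAlgHom : FunField W →+* FunField W)) (ρ⁻¹ (xGen W)) ≤ 1 := by
    change V.valuation (ρ (ρ⁻¹ (xGen W))) ≤ 1
    rwa [h3, V.valuation_le_one_iff]
  have h5 := (mem_autO_iff_forall W).mp (inv_mem hρ) (xGen W)
  exact (one_lt_inftyValuation_xGen W).not_ge (h5.mp (h2.mpr h4))

omit [W.IsElliptic] in
lemma yGen_mem_comap {ρ : Aut W} {V : ValuationSubring (FunField W)}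
    (hV : ∀ a : F, ι a ∈ V) (hx : ρ (xGen W) ∈ V) : ρ (yGen W) ∈ V := by
  rcases V.mem_or_inv_mem (ρ (yGen W)) with h | h
  · exact h
  by_cases h0 : ρ (yGen W) = 0
  · rw [h0]; exact zero_mem V
  have h1 := congr_arg ρ (gen_relation W)
  simp only [map_add, map_mul, map_pow, AlgEquiv.commutes] at h1
  have h2 : ρ (yGen W) = (ρ (xGen W) ^ 3 + ι W.a₂ * ρ (xGen W) ^ 2 + ι W.a₄ * ρ (xGen W) + ι W.a₆) *
      (ρ (yGen W))⁻¹ - (ι W.a₁ * ρ (xGen W) + ι W.a₃) := by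
    rw [← h1]
    field_simp
    ring
  rw [h2]
  exact sub_mem (mul_mem (add_mem (add_mem (add_mem (pow_mem hx 3) (mul_mem (hV _) (pow_mem hx 2)))
    (mul_mem (hV _) hx)) (hV _)) h) (add_mem (mul_mem (hV _) hx) (hV _))

lemma exists_algebraMap_eq_apply_xGen {ρ : Aut W} (hρ : ρ ∈ autO W) :
    ∃ f : W.toAffine.CoordinateRing, ρ (xGen W) = algebraMap _ _ f := by
  obtain ⟨p, q, h⟩ := exists_aeval_eq_of_forall_mem W fun V hV hx ↦ xGen_mem_comap W hρ hV hx
  exact ⟨_, h.trans (algebraMap_smul_basis W p q).symm⟩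

lemma exists_algebraMap_eq_apply_yGen {ρ : Aut W} (hρ : ρ ∈ autO W) :
    ∃ f : W.toAffine.CoordinateRing, ρ (yGen W) = algebraMap _ _ f := by
  obtain ⟨p, q, h⟩ := exists_aeval_eq_of_forall_mem W fun V hV hx ↦
    yGen_mem_comap W hV (xGen_mem_comap W hρ hV hx)
  exact ⟨_, h.trans (algebraMap_smul_basis W p q).symm⟩

local notation "v" => inftyValuation W

lemma inftyValuation_apply_xGen {ρ : Aut W} (hρ : ρ ∈ autO W) :
    v (ρ (xGen W)) = WithZero.exp 2 := by
  have key {ρ : Aut W} (hρ : ρ ∈ autO W) : ∃ f : W.toAffine.CoordinateRing, f ≠ 0 ∧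
      ρ (xGen W) = algebraMap _ _ f ∧ v (ρ (xGen W)) = WithZero.exp (poleOrder W f : ℤ) ∧
      poleOrder W f ≠ 1 := by
    obtain ⟨f, hf⟩ := exists_algebraMap_eq_apply_xGen W hρ
    have hf0 : f ≠ 0 := by
      rintro rfl
      have := (mem_autO_iff W).mp hρ
      rw [hf, map_zero, map_zero] at this
      exact not_lt_zero this
    exact ⟨f, hf0, hf, by rw [hf, inftyValuation_algebraMap_of_ne_zero W hf0],
      CoordinateRing.natDegree_norm_ne_one f⟩
  obtain ⟨f, hf0, hf, hfv, hf1⟩ := key hρ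
  obtain ⟨g, hg0, hg, hgv, hg1⟩ := key (inv_mem hρ)
  have h1 := map_algebraMap_sq ((inftyValuation W).comap
    (ρ.toAlgHom : FunField W →+* FunField W)) ((mem_autO_iff W).mp hρ) hg0
  rw [← hg] at h1
  change v (ρ (ρ⁻¹ (xGen W))) ^ 2 = v (ρ (xGen W)) ^ _ at h1
  rw [show ρ (ρ⁻¹ (xGen W)) = xGen W from ρ.apply_symm_apply _, hfv, inftyValuation_xGen,
    ← WithZero.exp_nsmul, ← WithZero.exp_nsmul, WithZero.exp_inj] at h1
  -- Evaluating `x = ρ (ρ⁻¹ x)` shows that the pole orders of `ρ x` and `ρ⁻¹ x` multiply to 4.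
  -- Neither is 1, since no regular function has just a simple pole at `O`, so both are 2.
  have h2 : poleOrder W g * poleOrder W f = 4 := by
    simp only [nsmul_eq_mul] at h1
    push_cast at h1
    have : ((poleOrder W g * poleOrder W f : ℕ) : ℤ) = 4 := by push_cast; linarith
    exact_mod_cast this
  have h3 : poleOrder W f = 2 := by
    have hle : poleOrder W f ≤ 4 := Nat.le_of_dvd (by norm_num) ⟨_, by rw [mul_comm]; exact h2.symm⟩
    interval_cases hk : poleOrder W f <;> omega
  rw [hfv, h3]
  rfl

/-- An automorphism fixing the infinite place is given by an admissible change of variables that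
preserves the Weierstrass equation. -/
theorem exists_variableChange {ρ : Aut W} (hρ : ρ ∈ autO W) :
    ∃ c : VariableChange F, c • W = W ∧ ρ (xGen W) = ι (c.u ^ 2) * xGen W + ι c.r ∧
      ρ (yGen W) = ι (c.u ^ 3) * yGen W + ι (c.u ^ 2 * c.s) * xGen W + ι c.t := by
  have hvx := inftyValuation_apply_xGen W hρ
  have hvy : v (ρ (yGen W)) = WithZero.exp 3 := by
    have h := map_yGen_sq ((inftyValuation W).comap
      (ρ.toAlgHom : FunField W →+* FunField W)) ((mem_autO_iff W).mp hρ)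
    change v (ρ (yGen W)) ^ 2 = v (ρ (xGen W)) ^ 3 at h
    rw [hvx] at h
    have h' : (WithZero.exp 3 : ℤᵐ⁰) ^ 2 = (WithZero.exp 2) ^ 3 := by
      rw [← WithZero.exp_nsmul, ← WithZero.exp_nsmul]; rfl
    exact (pow_left_inj₀ zero_le zero_le two_ne_zero).mp (h.trans h'.symm)
  have key {f : FunField W} {g : W.toAffine.CoordinateRing} {n : ℕ} (hf : f = algebraMap _ _ g)
      (hv : v f = WithZero.exp (n : ℤ)) : g ≠ 0 ∧ poleOrder W g = n := by
    have hg : g ≠ 0 := by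
      rintro rfl
      rw [hf, map_zero, map_zero] at hv
      exact WithZero.exp_ne_zero hv.symm
    rw [hf, inftyValuation_algebraMap_of_ne_zero W hg, WithZero.exp_inj] at hv
    exact ⟨hg, by exact_mod_cast hv⟩
  obtain ⟨a, b, ha, hab⟩ : ∃ a b : F, a ≠ 0 ∧ ρ (xGen W) = ι a * xGen W + ι b := by
    obtain ⟨f, hf⟩ := exists_algebraMap_eq_apply_xGen W hρ
    obtain ⟨p, q, rfl, hpq⟩ := exists_algebraMap_eq W f
    obtain ⟨h1, h2⟩ := key (n := 2) hf hvx
    obtain ⟨-, h3, h4⟩ := poleOrder_cases W h1 h2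
    have hq : q = 0 := h3.resolve_right (by omega)
    have hp : p.natDegree = 1 := by omega
    obtain ⟨a, ha, b, rfl⟩ := natDegree_eq_one.mp hp
    refine ⟨a, b, ha, ?_⟩
    rw [hf, hpq, hq]
    simp
  obtain ⟨c, d, e, hc, hcde⟩ : ∃ c d e : F, c ≠ 0 ∧
      ρ (yGen W) = ι c * yGen W + ι d * xGen W + ι e := by
    obtain ⟨f, hf⟩ := exists_algebraMap_eq_apply_yGen W hρ
    obtain ⟨p, q, rfl, hpq⟩ := exists_algebraMap_eq W f
    obtain ⟨h1, h2⟩ := key (n := 3) hf hvy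
    obtain ⟨h3, -, h4⟩ := poleOrder_cases W h1 h2
    have hp : p.natDegree ≤ 1 := by
      rcases h3 with rfl | h3
      · simp
      · omega
    have hq : q ≠ 0 ∧ q.natDegree = 0 := by
      rcases h4 with h4 | h4
      · omega
      · exact ⟨h4.1, by omega⟩
    obtain ⟨c, rfl⟩ := natDegree_eq_zero.mp hq.2
    obtain ⟨d, e, rfl⟩ := exists_eq_X_add_C_of_natDegree_le_one hp
    refine ⟨c, d, e, by simpa using hq.1, ?_⟩
    rw [hf, hpq]
    simp
    ring
  have hrel := congr_arg ρ (gen_relation W)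
  simp only [map_add, map_mul, map_pow, AlgEquiv.commutes, hab, hcde] at hrel
  -- `ρ` of the Weierstrass equation minus `c²` times the equation is written in the basis `1, y`;
  -- its coefficients give the transformation rules for the `aᵢ`.
  obtain ⟨hp, hq⟩ := aeval_add_aeval_mul_eq_zero W
    (p := C (c ^ 2 - a ^ 3) * X ^ 3 +
      C (c ^ 2 * W.a₂ + d ^ 2 + W.a₁ * a * d - 3 * a ^ 2 * b - W.a₂ * a ^ 2) * X ^ 2 +
      C (c ^ 2 * W.a₄ + 2 * d * e + W.a₁ * (a * e + b * d) + W.a₃ * d - 3 * a * b ^ 2 -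
        2 * W.a₂ * a * b - W.a₄ * a) * X +
      C (c ^ 2 * W.a₆ + e ^ 2 + W.a₁ * b * e + W.a₃ * e - b ^ 3 - W.a₂ * b ^ 2 - W.a₄ * b - W.a₆))
    (q := C (2 * c * d + W.a₁ * a * c - c ^ 2 * W.a₁) * X +
      C (2 * c * e + W.a₁ * b * c + W.a₃ * c - c ^ 2 * W.a₃)) (by
    simp only [map_add, map_sub, map_mul, map_pow, aeval_X, aeval_C, map_ofNat]
    linear_combination hrel - ι c ^ 2 * gen_relation W)
  have p3 := congr_arg (coeff · 3) hp
  have p2 := congr_arg (coeff · 2) hp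
  have p1 := congr_arg (coeff · 1) hp
  have p0 := congr_arg (coeff · 0) hp
  have q1 := congr_arg (coeff · 1) hq
  have q0 := congr_arg (coeff · 0) hq
  simp only [coeff_add, coeff_C_mul, coeff_X_pow, coeff_X, coeff_C, coeff_zero] at p3 p2 p1 p0 q1 q0
  norm_num at p3 p2 p1 p0 q1 q0
  -- The leading coefficients satisfy `c² = a³`, so `u = c / a` has `u² = a` and `u³ = c`.
  obtain ⟨u, hu⟩ : ∃ u : Fˣ, (u : F) = c / a := ⟨Units.mk0 _ (div_ne_zero hc ha), rfl⟩
  have ha' : a = u ^ 2 := by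
    rw [hu]
    field_simp
    linear_combination -p3
  have hc' : c = u ^ 3 := by
    rw [pow_succ, ← ha', hu]
    field_simp
  have hu0 : (u : F) ≠ 0 := u.ne_zero
  obtain ⟨s, hs⟩ : ∃ s : F, d = u ^ 2 * s := ⟨d / u ^ 2, by field_simp⟩
  clear hu
  subst ha' hc' hs
  refine ⟨⟨u, b, s, e⟩, ?_, hab, hcde⟩
  have r1 : W.a₁ + 2 * s = u * W.a₁ := by
    refine mul_left_cancel₀ (pow_ne_zero 5 hu0) ?_
    linear_combination q1
  have r2 : W.a₂ - s * W.a₁ + 3 * b - s ^ 2 = u ^ 2 * W.a₂ := by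
    refine mul_left_cancel₀ (pow_ne_zero 4 hu0) ?_
    linear_combination -p2
  have r3 : W.a₃ + b * W.a₁ + 2 * e = u ^ 3 * W.a₃ := by
    refine mul_left_cancel₀ (pow_ne_zero 3 hu0) ?_
    linear_combination q0
  have r4 : W.a₄ - s * W.a₃ + 2 * b * W.a₂ - (e + b * s) * W.a₁ + 3 * b ^ 2 - 2 * s * e =
      u ^ 4 * W.a₄ := by
    refine mul_left_cancel₀ (pow_ne_zero 2 hu0) ?_
    linear_combination -p1
  have r6 : W.a₆ + b * W.a₄ + b ^ 2 * W.a₂ + b ^ 3 - e * W.a₃ - e ^ 2 - b * e * W.a₁ =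
      u ^ 6 * W.a₆ := by
    linear_combination -p0
  rw [variableChange_def]
  ext <;> simp only [r1, r2, r3, r4, r6, Units.val_inv_eq_inv_val] <;> field_simp

end EllipticFunctionField
end

/-! ### The scaling character and the action of changes of variables on translations. -/

noncomputable section

namespace EllipticFunctionField

open WeierstrassCurve WeierstrassCurve.Affine Polynomial

variable {F : Type*} [Field F] (W : WeierstrassCurve F)

local notation "ι" => algebraMap F (FunField W)

/-! ### Linear automorphisms -/

/-- The automorphism `ρ` is given by the change of variables `c`. -/
structure IsLinearBy (ρ : Aut W) (c : VariableChange F) : Prop where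
  apply_xGen : ρ (xGen W) = ι (c.u ^ 2) * xGen W + ι c.r
  apply_yGen : ρ (yGen W) = ι (c.u ^ 3) * yGen W + ι (c.u ^ 2 * c.s) * xGen W + ι c.t
  a₁ : W.a₁ + 2 * c.s = c.u * W.a₁
  a₂ : W.a₂ - c.s * W.a₁ + 3 * c.r - c.s ^ 2 = c.u ^ 2 * W.a₂
  a₃ : W.a₃ + c.r * W.a₁ + 2 * c.t = c.u ^ 3 * W.a₃
  a₄ : W.a₄ - c.s * W.a₃ + 2 * c.r * W.a₂ - (c.t + c.r * c.s) * W.a₁ + 3 * c.r ^ 2 -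
    2 * c.s * c.t = c.u ^ 4 * W.a₄
  a₆ : W.a₆ + c.r * W.a₄ + c.r ^ 2 * W.a₂ + c.r ^ 3 - c.t * W.a₃ - c.t ^ 2 - c.r * c.t * W.a₁ =
    c.u ^ 6 * W.a₆
  u_pow : (c.u : F) ^ 12 = 1

lemma exists_isLinearBy [W.IsElliptic] {ρ : Aut W} (hρ : ρ ∈ autO W) :
    ∃ c, IsLinearBy W ρ c := by
  obtain ⟨c, hc, hx, hy⟩ := exists_variableChange W hρ
  have hu := c.u.ne_zero
  have h1 := congr_arg WeierstrassCurve.a₁ hc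
  have h2 := congr_arg WeierstrassCurve.a₂ hc
  have h3 := congr_arg WeierstrassCurve.a₃ hc
  have h4 := congr_arg WeierstrassCurve.a₄ hc
  have h6 := congr_arg WeierstrassCurve.a₆ hc
  have hΔ := congr_arg WeierstrassCurve.Δ hc
  rw [variableChange_a₁, Units.val_inv_eq_inv_val] at h1
  rw [variableChange_a₂, Units.val_inv_eq_inv_val] at h2
  rw [variableChange_a₃, Units.val_inv_eq_inv_val] at h3
  rw [variableChange_a₄, Units.val_inv_eq_inv_val] at h4
  rw [variableChange_a₆, Units.val_inv_eq_inv_val] at h6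
  rw [variableChange_Δ] at hΔ
  have key {n : ℕ} {A B : F} (h : (c.u : F)⁻¹ ^ n * A = B) : A = c.u ^ n * B := by
    rw [← h, inv_pow, mul_inv_cancel_left₀ (pow_ne_zero n hu)]
  refine ⟨c, hx, hy, ?_, key h2, key h3, key h4, key h6, ?_⟩
  · rw [← pow_one (c.u : F)]
    exact key (by rwa [pow_one])
  -- The change of variables multiplies the nonzero discriminant by `u⁻¹²` and leaves it unchanged.
  · have hΔ0 : W.Δ ≠ 0 := W.coe_Δ' ▸ W.Δ'.ne_zero
    have := mul_right_cancel₀ hΔ0 (hΔ.trans (one_mul _).symm)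
    rwa [Units.val_inv_eq_inv_val, inv_pow, inv_eq_one] at this

lemma linear_eq_zero {a b c : F} (h : ι a * yGen W + ι b * xGen W + ι c = 0) :
    a = 0 ∧ b = 0 ∧ c = 0 := by
  obtain ⟨h1, h2⟩ := aeval_add_aeval_mul_eq_zero W (p := C b * X + C c) (q := C a) (by
    simp only [map_add, map_mul, aeval_X, aeval_C]
    linear_combination h)
  have h3 := congr_arg (coeff · 1) h1
  have h4 := congr_arg (coeff · 0) h1
  simp at h2 h3 h4
  exact ⟨h2, h3, h4⟩

lemma linear_xGen_inj {b c b' c' : F} (h : ι b * xGen W + ι c = ι b' * xGen W + ι c') :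
    b = b' ∧ c = c' := by
  obtain ⟨-, h1, h2⟩ := linear_eq_zero W (a := 0) (b := b - b') (c := c - c') (by
    simp only [map_sub, map_zero]
    linear_combination h)
  exact ⟨sub_eq_zero.mp h1, sub_eq_zero.mp h2⟩

lemma linear_yGen_inj {a b c a' b' c' : F}
    (h : ι a * yGen W + ι b * xGen W + ι c = ι a' * yGen W + ι b' * xGen W + ι c') :
    a = a' ∧ b = b' ∧ c = c' := by
  obtain ⟨h0, h1, h2⟩ := linear_eq_zero W (a := a - a') (b := b - b') (c := c - c') (by
    simp only [map_sub]
    linear_combination h)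
  exact ⟨sub_eq_zero.mp h0, sub_eq_zero.mp h1, sub_eq_zero.mp h2⟩

variable {W}

namespace IsLinearBy

variable {ρ σ : Aut W} {c d : VariableChange F}

lemma unique (hc : IsLinearBy W ρ c) (hd : IsLinearBy W ρ d) : c = d := by
  obtain ⟨h1, h2⟩ := linear_xGen_inj W (hc.apply_xGen.symm.trans hd.apply_xGen)
  obtain ⟨h3, h4, h5⟩ := linear_yGen_inj W (hc.apply_yGen.symm.trans hd.apply_yGen)
  have hu : c.u = d.u := by
    apply Units.ext
    refine mul_left_cancel₀ (pow_ne_zero 2 c.u.ne_zero) ?_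
    rw [← pow_succ, h3, h1]
    ring
  rw [hu] at h4
  exact VariableChange.ext hu h2 (mul_left_cancel₀ (pow_ne_zero 2 d.u.ne_zero) h4) h5

lemma eq_of_eq (hρ : IsLinearBy W ρ c) (hσ : IsLinearBy W σ c) : ρ = σ := by
  have := algHom_ext W (σ := ρ.toAlgHom) (τ := σ.toAlgHom) (hρ.apply_xGen.trans hσ.apply_xGen.symm)
    (hρ.apply_yGen.trans hσ.apply_yGen.symm)
  exact AlgEquiv.ext fun f ↦ DFunLike.congr_fun this f

lemma mul_apply_xGen (hρ : IsLinearBy W ρ c) (hσ : IsLinearBy W σ d) :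
    (ρ * σ) (xGen W) = ι (d.u ^ 2 * c.u ^ 2) * xGen W + ι (d.u ^ 2 * c.r + d.r) := by
  rw [AlgEquiv.mul_apply, hσ.apply_xGen]
  simp only [map_add, map_mul, AlgEquiv.commutes, hρ.apply_xGen]
  ring

lemma mul_apply_yGen (hρ : IsLinearBy W ρ c) (hσ : IsLinearBy W σ d) :
    (ρ * σ) (yGen W) = ι (d.u ^ 3 * c.u ^ 3) * yGen W +
      ι (d.u ^ 3 * (c.u ^ 2 * c.s) + d.u ^ 2 * d.s * c.u ^ 2) * xGen W +
      ι (d.u ^ 3 * c.t + d.u ^ 2 * d.s * c.r + d.t) := by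
  rw [AlgEquiv.mul_apply, hσ.apply_yGen]
  simp only [map_add, map_mul, AlgEquiv.commutes, hρ.apply_yGen, hρ.apply_xGen]
  ring

lemma one (hρ : IsLinearBy W 1 c) : c = 1 := by
  obtain ⟨h1, h2⟩ := linear_xGen_inj W (b' := 1) (c' := 0) (hρ.apply_xGen.symm.trans (by simp))
  obtain ⟨h3, h4, h5⟩ := linear_yGen_inj W (a' := 1) (b' := 0) (c' := 0)
    (hρ.apply_yGen.symm.trans (by simp))
  have hu : c.u = 1 := by
    apply Units.ext
    have : (c.u : F) ^ 3 = c.u ^ 2 * c.u := by ring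
    rwa [h1, h3, one_mul, eq_comm] at this
  have hs : c.s = 0 := by simpa [hu] using h4
  exact VariableChange.ext hu h2 hs h5

end IsLinearBy

variable [W.IsElliptic]

variable (W) in
/-- The scaling factor `u` of the automorphisms `x ↦ u²x + r`, `y ↦ u³y + u²sx + t`. -/
def scaling : autO W →* F where
  toFun ρ := ((exists_isLinearBy W ρ.2).choose.u : F)
  map_one' := by
    rw [(exists_isLinearBy W (autO W).one_mem).choose_spec.one]
    rfl
  map_mul' ρ σ := by
    have h1 := (exists_isLinearBy W ρ.2).choose_spec
    have h2 := (exists_isLinearBy W σ.2).choose_spec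
    have h3 := (exists_isLinearBy W (ρ * σ).2).choose_spec
    obtain ⟨h4, -⟩ := linear_xGen_inj W (h3.apply_xGen.symm.trans (h1.mul_apply_xGen h2))
    obtain ⟨h5, -, -⟩ := linear_yGen_inj W (h3.apply_yGen.symm.trans (h1.mul_apply_yGen h2))
    generalize (exists_isLinearBy W ρ.2).choose = c at *
    generalize (exists_isLinearBy W σ.2).choose = d at *
    generalize (exists_isLinearBy W (ρ * σ).2).choose = e at *
    refine mul_left_cancel₀ (pow_ne_zero 2 e.u.ne_zero) ?_
    rw [← pow_succ, h5, h4]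
    ring

lemma IsLinearBy.scaling_eq {ρ : autO W} {c : VariableChange F} (h : IsLinearBy W (ρ : Aut W) c) :
    scaling W ρ = c.u := by
  rw [h.unique (exists_isLinearBy W ρ.2).choose_spec]
  rfl

lemma scaling_pow (ρ : autO W) : scaling W ρ ^ 12 = 1 := by
  obtain ⟨c, hc⟩ := exists_isLinearBy W ρ.2
  rw [hc.scaling_eq]
  exact hc.u_pow

/-! ### Conjugation of translations -/

variable (W) in
open Classical in
-- With the slope as an explicit witness, conjugates of translations can be recognized by polynomial
-- identities.
lemma isTranslationBy_some_iff {τ : Aut W} {a b : F} {hQ : (W.toAffine⁄F).Nonsingular a b} :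
    IsTranslationBy W τ (.some a b hQ) ↔
      ∃ ℓ, ℓ * (xGen W - ι a) = yGen W + ι b + ι W.a₁ * ι a + ι W.a₃ ∧
        τ (xGen W) = ℓ ^ 2 + ι W.a₁ * ℓ - ι W.a₂ - xGen W - ι a ∧
        τ (yGen W) = -(ℓ * (τ (xGen W) - xGen W) + yGen W) - ι W.a₁ * τ (xGen W) - ι W.a₃ := by
  have hxa : xGen W ≠ ι a := by
    intro hx
    have h1 := one_lt_inftyValuation_xGen W
    rw [hx] at h1
    exact h1.not_ge (map_algebraMap_le_one _ a)
  have hm : xGen W - ι a ≠ 0 := sub_ne_zero.mpr hxa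
  have key {ℓ : FunField W} (hℓ : ℓ * (xGen W - ι a) = yGen W + ι b + ι W.a₁ * ι a + ι W.a₃) :
      IsTranslationBy W τ (.some a b hQ) ↔
        τ (xGen W) = ℓ ^ 2 + ι W.a₁ * ℓ - ι W.a₂ - xGen W - ι a ∧
        τ (yGen W) = -(ℓ * (τ (xGen W) - xGen W) + yGen W) - ι W.a₁ * τ (xGen W) - ι W.a₃ := by
    obtain ⟨h₃, hadd⟩ := some_sub_baseChange_some W
      (nonsingular_of_equation W (equation_gen W)) hQ hxa hℓ rfl rfl
    obtain ⟨_, h2⟩ := map_genericPoint W τ.toAlgHom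
    rw [IsTranslationBy, h2, genericPoint, hadd, Point.some.injEq]
    refine and_congr_right fun h ↦ ?_
    rw [← h]
    rfl
  refine ⟨fun h ↦ ?_, fun ⟨ℓ, hℓ, h⟩ ↦ (key hℓ).mpr h⟩
  have hℓ := div_mul_cancel₀ (yGen W + ι b + ι W.a₁ * ι a + ι W.a₃) hm
  exact ⟨_, hℓ, (key hℓ).mp h⟩

variable (W) in
open Classical in
lemma isTranslationBy_injective {τ : Aut W} {P Q : (W.toAffine⁄F).Point}
    (hP : IsTranslationBy W τ P) (hQ : IsTranslationBy W τ Q) : P = Q := by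
  rw [IsTranslationBy] at hP hQ
  exact Point.map_injective (W' := W.toAffine) (Algebra.ofId F (FunField W))
    (sub_right_injective (hP.symm.trans hQ))

lemma IsLinearBy.isTranslationBy_conj {ρ : Aut W} {c : VariableChange F} (h : IsLinearBy W ρ c)
    {τ : Aut W} {a b : F} {hQ : (W.toAffine⁄F).Nonsingular a b}
    (hτ : IsTranslationBy W τ (.some a b hQ)) :
    ∃ hQ' : (W.toAffine⁄F).Nonsingular (c.u ^ 2 * a + c.r) (c.u ^ 3 * b + c.u ^ 2 * c.s * a + c.t),
      IsTranslationBy W (ρ⁻¹ * τ * ρ) (.some _ _ hQ') := by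
  have hQE := (W.toAffine.equation_iff a b).mp hQ.1
  have hQ' : (W.toAffine⁄F).Nonsingular (c.u ^ 2 * a + c.r)
      (c.u ^ 3 * b + c.u ^ 2 * c.s * a + c.t) := by
    refine equation_iff_nonsingular (W := W).mp ((W.toAffine.equation_iff _ _).mpr ?_)
    linear_combination (c.u : F) ^ 6 * hQE + a * b * c.u ^ 5 * h.a₁ - a ^ 2 * c.u ^ 4 * h.a₂ +
      b * c.u ^ 3 * h.a₃ - a * c.u ^ 2 * h.a₄ - h.a₆
  refine ⟨hQ', (isTranslationBy_some_iff W).mpr ?_⟩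
  obtain ⟨ℓ, h1, h2, h3⟩ := (isTranslationBy_some_iff W).mp hτ
  have hι (z : F) : ρ⁻¹ (ι z) = ι z := AlgEquiv.commutes _ z
  have hx : xGen W = ι (c.u ^ 2) * ρ⁻¹ (xGen W) + ι c.r := by
    have := congr_arg (⇑(ρ⁻¹ : Aut W)) h.apply_xGen
    rw [map_add, map_mul, hι, hι] at this
    rw [← this]
    exact (ρ.symm_apply_apply _).symm
  have hy : yGen W = ι (c.u ^ 3) * ρ⁻¹ (yGen W) + ι (c.u ^ 2 * c.s) * ρ⁻¹ (xGen W) + ι c.t := by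
    have := congr_arg (⇑(ρ⁻¹ : Aut W)) h.apply_yGen
    rw [map_add, map_add, map_mul, map_mul, hι, hι, hι] at this
    rw [← this]
    exact (ρ.symm_apply_apply _).symm
  have hX : (ρ⁻¹ * τ * ρ) (xGen W) = ι (c.u ^ 2) * ρ⁻¹ (τ (xGen W)) + ι c.r := by
    rw [AlgEquiv.mul_apply, AlgEquiv.mul_apply, h.apply_xGen]
    simp only [map_add, map_mul, map_pow, AlgEquiv.commutes]
  have hY : (ρ⁻¹ * τ * ρ) (yGen W) = ι (c.u ^ 3) * ρ⁻¹ (τ (yGen W)) +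
      ι (c.u ^ 2 * c.s) * ρ⁻¹ (τ (xGen W)) + ι c.t := by
    rw [AlgEquiv.mul_apply, AlgEquiv.mul_apply, h.apply_yGen]
    simp only [map_add, map_mul, map_pow, AlgEquiv.commutes]
  have e1 := congr_arg (⇑(ρ⁻¹ : Aut W)) h1
  have e2 := congr_arg (⇑(ρ⁻¹ : Aut W)) h2
  have e3 := congr_arg (⇑(ρ⁻¹ : Aut W)) h3
  simp only [map_add, map_sub, map_mul, map_neg, map_pow, hι] at e1 e2 e3
  have r1 := congr_arg ι h.a₁
  have r2 := congr_arg ι h.a₂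
  have r3 := congr_arg ι h.a₃
  simp only [map_add, map_sub, map_mul, map_pow, map_ofNat] at r1 r2 r3 hx hy hX hY ⊢
  generalize ρ⁻¹ (xGen W) = x' at *
  generalize ρ⁻¹ (yGen W) = y' at *
  generalize ρ⁻¹ ℓ = ℓ' at *
  generalize ρ⁻¹ (τ (xGen W)) = X' at *
  generalize ρ⁻¹ (τ (yGen W)) = Y' at *
  -- A line of slope `ℓ'` is carried to one of slope `(u³ℓ' + u²s) / u²`.
  refine ⟨ι c.u * ℓ' + ι c.s, ?_, ?_, ?_⟩
  · rw [hx, hy]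
    linear_combination ι c.u ^ 3 * e1 - ι c.u ^ 2 * ι a * r1 - r3
  · rw [hX, hx]
    linear_combination ι c.u ^ 2 * e2 - ι c.u * ℓ' * r1 + r2
  · rw [hX, hY, hx, hy]
    linear_combination ι c.u ^ 3 * e3 + ι c.u ^ 2 * X' * r1 + r3

end EllipticFunctionField
end

/-! ### The projection `π` and vanishing sums of conjugates of the generic point. -/

noncomputable section

namespace EllipticFunctionField

open WeierstrassCurve WeierstrassCurve.Affine Polynomial

variable {F : Type*} [Field F] (W : WeierstrassCurve F)

local notation "ι" => algebraMap F (FunField W)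

variable [W.IsElliptic]

/-! ### The projection onto the stabilizer of the infinite place -/

lemma isTranslationBy_zero_iff {τ : Aut W} : IsTranslationBy W τ 0 ↔ τ = 1 := by
  classical
  rw [IsTranslationBy, map_zero, sub_zero]
  refine ⟨fun h ↦ aut_ext W ?_, fun h ↦ ?_⟩
  · rw [map_one_point, h]
  · rw [h, map_one_point]

instance : (translationGroup W).Normal := by
  refine ⟨fun τ hτ σ ↦ ?_⟩
  obtain ⟨τ', hτ', ρ, hρ, h⟩ := exists_translation_mul_autO W σ⁻¹
  obtain rfl : σ = ρ⁻¹ * τ'⁻¹ := by rw [← inv_inj, h, mul_inv_rev, inv_inv, inv_inv]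
  have : ρ⁻¹ * τ'⁻¹ * τ * (ρ⁻¹ * τ'⁻¹)⁻¹ = ρ⁻¹ * τ * ρ := by
    rw [mul_assoc ρ⁻¹, translationGroup_comm W (inv_mem hτ') hτ]
    group
  rw [this]
  obtain ⟨c, hc⟩ := exists_isLinearBy W hρ
  obtain ⟨_ | ⟨a, b, hQ⟩, hτQ⟩ := hτ
  · rw [(isTranslationBy_zero_iff W).mp hτQ, mul_one, inv_mul_cancel]
    exact one_mem _
  · obtain ⟨_, h⟩ := hc.isTranslationBy_conj hτQ
    exact ⟨_, h⟩

lemma isComplement'_autO_translationGroup : (autO W).IsComplement' (translationGroup W) := by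
  refine Subgroup.isComplement'_of_disjoint_and_mul_eq_univ ?_ ?_
  · rw [Subgroup.disjoint_def]
    exact fun hO hT ↦ eq_one_of_mem_translationGroup_of_mem_autO W hT hO
  · refine Set.eq_univ_of_forall fun σ ↦ ?_
    obtain ⟨τ, hτ, ρ, hρ, h⟩ := exists_translation_mul_autO W σ⁻¹
    refine ⟨ρ⁻¹, inv_mem hρ, τ⁻¹, inv_mem hτ, ?_⟩
    rw [← inv_inj, h, mul_inv_rev, inv_inv, inv_inv]

lemma exists_projection :
    ∃ π : Aut W →* autO W, π.ker = translationGroup W ∧ ∀ ρ : autO W, π ρ = ρ := by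
  let e := (isComplement'_autO_translationGroup W).QuotientMulEquiv
  refine ⟨e.toMonoidHom.comp (QuotientGroup.mk' (translationGroup W)), ?_, fun ρ ↦ ?_⟩
  · ext σ
    rw [MonoidHom.mem_ker, MonoidHom.comp_apply, MulEquiv.coe_toMonoidHom,
      map_eq_one_iff _ e.injective, QuotientGroup.mk'_apply, QuotientGroup.eq_one_iff]
  · exact e.apply_symm_apply ρ

/-! ### Sums of conjugates of the generic point -/

variable {W}

open Classical in
-- Each `g^i η` differs from `(π g)^i η` by a constant point, so `η + gη + ... + g^(n-1)η` is
-- constant and hence fixed by `g`. Comparing it with its image under `g` leaves `g^n η = η`.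
lemma pow_eq_one_of_sum_eq_zero {π : Aut W →* autO W} (hker : π.ker = translationGroup W)
    (hπ : ∀ ρ : autO W, π ρ = ρ) {g : Aut W} {n : ℕ}
    (h : ∑ i ∈ Finset.range n, Point.map ((π g : Aut W) ^ i).toAlgHom (genericPoint W) = 0) :
    g ^ n = 1 := by
  have hT (i : ℕ) : ((π g : Aut W) ^ i)⁻¹ * g ^ i ∈ translationGroup W := by
    rw [← hker, MonoidHom.mem_ker, map_mul, map_inv, map_pow, map_pow, hπ, inv_mul_cancel]
  choose R hR using hT
  have hg (i : ℕ) : Point.map (g ^ i).toAlgHom (genericPoint W) =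
      Point.map ((π g : Aut W) ^ i).toAlgHom (genericPoint W) -
        Point.baseChange F (FunField W) (R i) := by
    have := hR i
    rw [IsTranslationBy] at this
    rw [← mul_inv_cancel_left ((π g : Aut W) ^ i) (g ^ i), map_mul_point, this, map_sub,
      Point.map_baseChange]
  have h1 : ∑ i ∈ Finset.range n, Point.map (g ^ i).toAlgHom (genericPoint W) =
      Point.baseChange F (FunField W) (-∑ i ∈ Finset.range n, R i) := by
    simp only [hg, Finset.sum_sub_distrib, h, map_neg, map_sum, zero_sub]
  have h2 := congr_arg (Point.map g.toAlgHom) h1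
  rw [Point.map_baseChange, ← h1, map_sum] at h2
  simp only [← map_mul_point, ← pow_succ'] at h2
  have h3 := Finset.sum_range_succ (fun i ↦ Point.map (g ^ i).toAlgHom (genericPoint W)) n
  rw [Finset.sum_range_succ', h2, add_right_inj, pow_zero] at h3
  exact aut_ext W h3.symm

lemma map_genericPoint_eq_neg {σ : Aut W} (hx : σ (xGen W) = xGen W) (hσ : σ ≠ 1) :
    Point.map σ.toAlgHom (genericPoint W) = -genericPoint W := by
  classical
  obtain ⟨h, h1⟩ := map_genericPoint W σ.toAlgHom
  rcases (Point.X_eq_iff (h₁ := h) (h₂ := nonsingular_of_equation W (equation_gen W))).mp hx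
    with h2 | h2
  · exact absurd (aut_ext W (by rw [h1, h2, map_one_point]; rfl)) hσ
  · rw [h1, h2]
    rfl

lemma mul_self_eq_one_of_apply_xGen {σ : Aut W} (hx : σ (xGen W) = xGen W) : σ * σ = 1 := by
  classical
  by_cases h : σ = 1
  · rw [h, mul_one]
  · apply aut_ext W
    rw [map_mul_point, map_genericPoint_eq_neg hx h, map_neg, map_genericPoint_eq_neg hx h, neg_neg,
      map_one_point]

open Classical in
-- The hypotheses express that `η, ση, σ²η` are the intersections of the curve with a line of
-- constant slope `m`: `hx` is Vieta's formula for the three `x`-coordinates.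
lemma sum_three_eq_zero {σ : Aut W} {m : F} (hne : xGen W ≠ σ (xGen W))
    (hy : σ (yGen W) - yGen W = ι m * (σ (xGen W) - xGen W))
    (hx : ι (m ^ 2 + W.a₁ * m - W.a₂) = xGen W + σ (xGen W) + σ (σ (xGen W))) :
    genericPoint W + Point.map σ.toAlgHom (genericPoint W) +
      Point.map (σ * σ : Aut W).toAlgHom (genericPoint W) = 0 := by
  obtain ⟨h1, e1⟩ := map_genericPoint W σ.toAlgHom
  obtain ⟨h2, e2⟩ := map_genericPoint W (σ * σ : Aut W).toAlgHom
  -- As `m` is fixed by `σ`, the chord from `ση` to `σ²η` has slope `m` as well.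
  have hy' := congr_arg σ hy
  simp only [map_sub, map_mul, map_add, map_pow, AlgEquiv.commutes] at hy' hx
  have hne' : xGen W ≠ σ.toAlgHom (xGen W) := hne
  obtain ⟨h3, e3⟩ := some_add_some W (nonsingular_of_equation W (equation_gen W)) h1 hne'
    (ℓ := ι m) (x₃ := σ (σ (xGen W)))
    (by change _ * (_ - σ (xGen W)) = _ - σ (yGen W); linear_combination hy)
    (by change _ = _ - _ - σ (xGen W); linear_combination -hx) rfl
  rw [add_eq_zero_iff_eq_neg, e1, e2, genericPoint]
  refine e3.trans ?_
  rw [Point.neg_some, Point.some.injEq]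
  refine ⟨rfl, ?_⟩
  simp only [negY, baseChange_a₁, baseChange_a₃]
  change _ = -σ (σ (yGen W)) - _ * σ (σ (xGen W)) - _
  linear_combination hy + hy'

/-! ### Automorphisms of order two and three -/

/-- Thus negation is the only possible involution. Composition gives `u² = 1` and `2r = 0`; in
characteristic 2 the rules for `a₂` and `a₃` are needed as well to get `r² = 0`. -/
lemma apply_xGen_of_mul_self_eq_one {ρ : Aut W} (hρ : ρ ∈ autO W) (h : ρ * ρ = 1) :
    ρ (xGen W) = xGen W := by
  obtain ⟨c, hc⟩ := exists_isLinearBy W hρ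
  have hx := hc.mul_apply_xGen hc
  have hy := hc.mul_apply_yGen hc
  rw [h, AlgEquiv.one_apply] at hx hy
  obtain ⟨h1, h2⟩ := linear_xGen_inj W (b := 1) (c := 0) (.trans (by simp) hx)
  obtain ⟨h3, -, h5⟩ := linear_yGen_inj W (a := 1) (b := 0) (c := 0) (.trans (by simp) hy)
  have hu : (c.u : F) ^ 2 = 1 := by linear_combination (c.u : F) ^ 2 * h1 - h3
  have hr : 2 * c.r = 0 := by linear_combination -h2 - c.r * hu
  have hr0 : c.r = 0 := by
    by_cases h2 : (2 : F) = 0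
    · have hu1 : (c.u : F) = 1 := by
        refine sub_eq_zero.mp (pow_eq_zero_iff two_ne_zero |>.mp ?_)
        linear_combination hu + (1 - c.u) * h2
      have e2 := hc.a₂
      have e3 := hc.a₃
      rw [hu1] at e2 e3 h5
      refine pow_eq_zero_iff two_ne_zero |>.mp ?_
      linear_combination c.r * e2 + c.s * e3 - c.s * h5 - c.r * hr - 2 * c.s * c.t * h2
    · exact (mul_eq_zero.mp hr).resolve_left h2
  rw [hc.apply_xGen, hu, hr0, map_one, one_mul, map_zero, add_zero]

open Classical in
lemma sum_three_eq_zero_of_mul_self_mul_self {ρ : Aut W} (hρ : ρ ∈ autO W) (h : ρ * ρ * ρ = 1)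
    (h1 : ρ ≠ 1) : genericPoint W + Point.map ρ.toAlgHom (genericPoint W) +
      Point.map (ρ * ρ : Aut W).toAlgHom (genericPoint W) = 0 := by
  obtain ⟨c, hc⟩ := exists_isLinearBy W hρ
  have hu : (c.u : F) ^ 3 = 1 := by
    have := congr_arg (scaling W) (show (⟨ρ, hρ⟩ * ⟨ρ, hρ⟩ * ⟨ρ, hρ⟩ : autO W) = 1 from
      Subtype.ext h)
    rw [map_mul, map_mul, map_one, IsLinearBy.scaling_eq (ρ := ⟨ρ, hρ⟩) hc] at this
    linear_combination this
  have hxx : ρ (xGen W) ≠ xGen W := by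
    intro hx
    rw [mul_self_eq_one_of_apply_xGen hx, one_mul] at h
    exact h1 h
  have hx := DFunLike.congr_fun h (xGen W)
  have hy := DFunLike.congr_fun h (yGen W)
  simp only [AlgEquiv.mul_apply, AlgEquiv.one_apply, hc.apply_xGen, hc.apply_yGen, map_add, map_mul,
    AlgEquiv.commutes] at hx hy
  obtain ⟨-, h3⟩ := linear_xGen_inj W (b := c.u ^ 6) (c := c.r * (c.u ^ 4 + c.u ^ 2 + 1)) (b' := 1)
    (c' := 0) (by simp only [map_add, map_mul, map_pow, map_one, map_zero] at hx ⊢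
                  linear_combination hx)
  obtain ⟨-, h4, h5⟩ := linear_yGen_inj W (a := c.u ^ 9)
    (b := c.s * (c.u ^ 8 + c.u ^ 7 + c.u ^ 6))
    (c := c.t * (c.u ^ 6 + c.u ^ 3 + 1) + c.s * c.r * (c.u ^ 5 + c.u ^ 4 + c.u ^ 2)) (a' := 1)
    (b' := 0) (c' := 0) (by
      simp only [map_add, map_mul, map_pow, map_one, map_zero] at hy ⊢
      linear_combination hy)
  have e1 := hc.a₁
  have e2 := hc.a₂
  have e3 := hc.a₃
  have e4 := hc.a₄
  -- If `u = 1`, then `x ↦ x + r` with `r ≠ 0` and `3r = 0`, so the characteristic is 3 and the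
  -- slope is `t / r = a₁`. Otherwise `u` is a primitive cube root of unity.
  by_cases hu1 : (c.u : F) = 1
  · rw [hu1] at e1 e2 e3 e4 h3
    have hr : c.r ≠ 0 := by
      intro hr
      apply hxx
      rw [hc.apply_xGen, hu1, hr]
      simp
    have h30 : (3 : F) = 0 := by
      refine (mul_eq_zero.mp ?_).resolve_left hr
      linear_combination h3
    have hs : c.s = 0 := by linear_combination c.s * h30 - e1
    have ht : c.t = c.r * W.a₁ := by linear_combination c.t * h30 - e3
    have ha : W.a₂ = -W.a₁ ^ 2 := by
      refine mul_left_cancel₀ hr ?_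
      rw [hs, ht] at e4
      linear_combination -e4 + (c.r * W.a₂ + c.r ^ 2) * h30
    refine sum_three_eq_zero (m := W.a₁) hxx.symm ?_ ?_
    · rw [hc.apply_xGen, hc.apply_yGen, hu1, hs, ht]
      simp
      ring
    · have h30' := congr_arg ι h30
      rw [hc.apply_xGen, hu1, ha]
      simp only [map_add, map_sub, map_neg, map_mul, map_pow, map_one, map_ofNat, map_zero,
        AlgEquiv.commutes, hc.apply_xGen, hu1] at h30' ⊢
      linear_combination (ι W.a₁ ^ 2 - xGen W - ι c.r) * h30'
  · have hu2 : (c.u : F) ^ 2 + c.u + 1 = 0 := by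
      refine (mul_eq_zero.mp ?_).resolve_left (sub_ne_zero.mpr hu1)
      linear_combination hu
    have h30 : (3 : F) ≠ 0 := by
      intro h30
      refine hu1 (sub_eq_zero.mp (pow_eq_zero_iff three_ne_zero |>.mp ?_))
      linear_combination hu + (c.u - c.u ^ 2) * h30
    -- `ρy - y = u²s x + t` and `ρx - x = (u² - 1)x + r`, so the slope must be `u²s / (u² - 1) = s /
    -- (1 - u)`.
    obtain ⟨m, hs⟩ : ∃ m, c.s = m * (1 - c.u) :=
      ⟨_, (div_mul_cancel₀ _ (sub_ne_zero.mpr (Ne.symm hu1))).symm⟩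
    rw [hs] at e1 e2 h5
    have ha₁ : W.a₁ = -2 * m := by
      refine mul_right_cancel₀ (sub_ne_zero.mpr (Ne.symm hu1)) ?_
      linear_combination e1
    have ha₂ : W.a₂ = -m ^ 2 - c.r * (1 - c.u) := by
      refine mul_left_cancel₀ h30 ?_
      rw [ha₁] at e2
      linear_combination (1 - c.u : F) * e2 + (2 - c.u) * (W.a₂ + m ^ 2) * hu2
    have ht : c.t = m * c.r := by
      refine mul_left_cancel₀ h30 ?_
      linear_combination h5 - (c.u ^ 3 + 2) * c.t * hu - m * c.r * hu2 -
        m * c.r * (c.u - 2 - c.u ^ 3) * hu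
    have hu2' := congr_arg ι hu2
    refine sum_three_eq_zero (m := m) hxx.symm ?_ ?_
    · rw [hc.apply_xGen, hc.apply_yGen, hu, hs, ht]
      have hu' := congr_arg ι hu
      simp only [map_sub, map_mul, map_pow, map_one] at hu' ⊢
      linear_combination -ι m * xGen W * hu'
    · rw [hc.apply_xGen, ha₁, ha₂]
      simp only [map_add, map_sub, map_neg, map_mul, map_pow, map_one, map_ofNat, map_zero,
        AlgEquiv.commutes, hc.apply_xGen] at hu2' ⊢
      linear_combination (-xGen W * (ι c.u ^ 2 - ι c.u + 1) - ι c.r) * hu2'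

end EllipticFunctionField
end

/-! ### Construction of the complements. -/

noncomputable section

namespace EllipticFunctionField

open WeierstrassCurve WeierstrassCurve.Affine Polynomial

variable {F : Type*} [Field F] (W : WeierstrassCurve F)

local notation "ι" => algebraMap F (FunField W)

variable [W.IsElliptic]

variable {W}

/-! ### Lifting elements of the stabilizer without changing their order -/

/-- Half the order gives an involution, hence negation, so the terms `i` and `i + m` of the sum of
conjugates cancel. -/
lemma pow_orderOf_eq_one_of_even {π : Aut W →* autO W} (hker : π.ker = translationGroup W)
    (hπ : ∀ ρ : autO W, π ρ = ρ) {g : Aut W} (hpos : 0 < orderOf (π g))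
    (heven : Even (orderOf (π g))) : g ^ orderOf (π g) = 1 := by
  classical
  obtain ⟨m, hm⟩ := heven
  have h1 : ((π g : Aut W)) ^ m ≠ 1 := by
    intro h
    exact pow_ne_one_of_lt_orderOf (x := π g) (n := m) (by omega) (by omega) (Subtype.ext h)
  have h2 : (π g : Aut W) ^ m * (π g : Aut W) ^ m = 1 := by
    rw [← pow_add, ← hm]
    exact congr_arg Subtype.val (pow_orderOf_eq_one (π g))
  have hx := apply_xGen_of_mul_self_eq_one (pow_mem (π g).2 m) h2
  apply pow_eq_one_of_sum_eq_zero hker hπ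
  rw [hm, Finset.sum_range_add, ← Finset.sum_add_distrib]
  refine Finset.sum_eq_zero fun i _ ↦ ?_
  rw [add_comm m i, pow_add, map_mul_point, map_genericPoint_eq_neg hx h1, map_neg, add_neg_cancel]

lemma pow_orderOf_eq_one_of_three {π : Aut W →* autO W} (hker : π.ker = translationGroup W)
    (hπ : ∀ ρ : autO W, π ρ = ρ) {g : Aut W} (h3 : orderOf (π g) = 3) :
    g ^ orderOf (π g) = 1 := by
  classical
  apply pow_eq_one_of_sum_eq_zero hker hπ
  have h : (π g : Aut W) ^ 3 = 1 := by
    rw [← h3]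
    exact congr_arg Subtype.val (pow_orderOf_eq_one (π g))
  rw [h3, Finset.sum_range_succ, Finset.sum_range_succ, Finset.sum_range_one, pow_zero, pow_one,
    map_one_point, pow_two]
  refine sum_three_eq_zero_of_mul_self_mul_self (π g).2 (by rw [← h, pow_succ, pow_two]) fun h1 ↦ ?_
  rw [orderOf_eq_one_iff.mpr (Subtype.ext h1)] at h3
  omega

instance [Finite F] : Finite (autO W) := by
  have : Finite (VariableChange F) :=
    Finite.of_injective (fun c ↦ (c.u, c.r, c.s, c.t)) fun c d h ↦ by
      simp only [Prod.mk.injEq] at h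
      exact VariableChange.ext h.1 h.2.1 h.2.2.1 h.2.2.2
  refine Finite.of_injective (fun ρ : autO W ↦ (exists_isLinearBy W ρ.2).choose) fun ρ σ h ↦ ?_
  have hρ := (exists_isLinearBy W ρ.2).choose_spec
  rw [show (exists_isLinearBy W ρ.2).choose = _ from h] at hρ
  exact Subtype.ext (hρ.eq_of_eq (exists_isLinearBy W σ.2).choose_spec)

variable {π : Aut W →* autO W} {G : Subgroup (Aut W)}

/-- `π(G)` embeds into the multiplicative group of a field, so it is cyclic. Its order divides 12,
so it is even, 1 or 3, and lifts of a generator are controlled in the nontrivial cases. -/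
lemma exists_complement_of_scaling_injOn [Finite F] (hker : π.ker = translationGroup W)
    (hπ : ∀ ρ : autO W, π ρ = ρ) (h : ∀ ρ ∈ G.map π, scaling W ρ = 1 → ρ = 1) :
    ∃ C ≤ G, C ⊓ π.ker = ⊥ ∧ ∀ h ∈ G, ∃ c ∈ C, π c = π h := by
  have hinj : Function.Injective ((scaling W).comp (G.map π).subtype) := by
    rw [injective_iff_map_eq_one]
    exact fun ρ hρ ↦ Subtype.ext (h ρ ρ.2 hρ)
  obtain ⟨⟨ζ, hζ⟩, hgen⟩ := (isCyclic_of_injective_ringHom _ hinj).exists_generator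
  obtain ⟨g, hg, rfl⟩ := hζ
  have hgen' (h) (hh : h ∈ G) : ∃ k : ℤ, π h = π g ^ k := by
    obtain ⟨k, hk⟩ := hgen ⟨π h, Subgroup.mem_map_of_mem π hh⟩
    exact ⟨k, (congr_arg Subtype.val hk).symm⟩
  have h12 : orderOf (π g) ∣ 12 := by
    apply orderOf_dvd_of_pow_eq_one
    exact h _ (pow_mem (Subgroup.mem_map_of_mem π hg) _) (by rw [map_pow, scaling_pow])
  have hpos : 0 < orderOf (π g) := orderOf_pos _
  rcases Nat.even_or_odd (orderOf (π g)) with heven | hodd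
  · exact exists_complement_of_zpowers π G g hg hgen' (pow_orderOf_eq_one_of_even hker hπ hpos heven)
  · have h3 : orderOf (π g) ∣ 3 := by
      refine Nat.Coprime.dvd_of_dvd_mul_left (m := 4) ?_ h12
      exact Nat.Coprime.pow_right 2 (Nat.coprime_two_right.mpr hodd)
    rcases (Nat.dvd_prime Nat.prime_three).mp h3 with h1 | h1
    -- Here `g` itself may be a nontrivial translation, so `1` is taken as the lift.
    · refine exists_complement_of_zpowers π G 1 G.one_mem (fun h hh ↦ ?_) (one_pow _)
      obtain ⟨k, hk⟩ := hgen' h hh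
      exact ⟨k, by rw [hk, orderOf_eq_one_iff.mp h1, map_one]⟩
    · exact exists_complement_of_zpowers π G g hg hgen' (pow_orderOf_eq_one_of_three hker hπ h1)

/-! ### Translations fixed by an automorphism -/

/-- `g` and `π g` differ by a translation, and translations commute. -/
lemma inv_mul_mul_eq_of_conj_eq (hker : π.ker = translationGroup W)
    (hπ : ∀ ρ : autO W, π ρ = ρ) {g τ : Aut W} (hτ : τ ∈ translationGroup W)
    (h : g * τ * g⁻¹ = τ) : (π g : Aut W)⁻¹ * τ * π g = τ := by
  have hT : (π g : Aut W)⁻¹ * g ∈ translationGroup W := by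
    rw [← hker, MonoidHom.mem_ker, map_mul, map_inv, hπ, inv_mul_cancel]
  have h1 := translationGroup_comm W hT hτ
  have h2 : g * τ = τ * g := by rw [← h, inv_mul_cancel_right, h]
  rw [mul_assoc, h2] at h1
  refine mul_right_cancel (b := (π g : Aut W)⁻¹ * g) ?_
  rw [← h1]
  group

/-- If `ρ` commutes with `τ_Q`, then `ρ` fixes `Q`; an affine rational point is excluded by `hfix`. -/
lemma eq_one_of_inv_mul_mul_eq {ρ τ : Aut W} {c : VariableChange F} (hc : IsLinearBy W ρ c)
    (hfix : ∀ a b, c.u ^ 2 * a + c.r = a → c.u ^ 3 * b + c.u ^ 2 * c.s * a + c.t ≠ b)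
    (hτ : τ ∈ translationGroup W) (h : ρ⁻¹ * τ * ρ = τ) : τ = 1 := by
  obtain ⟨_ | ⟨a, b, hQ⟩, hτQ⟩ := hτ
  · exact (isTranslationBy_zero_iff W).mp hτQ
  · obtain ⟨h', hτ'⟩ := hc.isTranslationBy_conj hτQ
    rw [h] at hτ'
    have := isTranslationBy_injective W hτ' hτQ
    rw [Point.some.injEq] at this
    exact absurd this.2 (hfix a b this.1)

/-! ### Automorphisms with scaling factor one -/

lemma eq_of_apply_xGen_eq {ρ σ : Aut W} (hρ : ρ (xGen W) = xGen W) (hρ1 : ρ ≠ 1)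
    (hσ : σ (xGen W) = xGen W) (hσ1 : σ ≠ 1) : ρ = σ := by
  classical
  exact aut_ext W (by rw [map_genericPoint_eq_neg hρ hρ1, map_genericPoint_eq_neg hσ hσ1])

omit [W.IsElliptic] in
-- The rules for `a₁` and `a₂` give `s = 0` and `3r = 0`, and `r = 0` would force `ρ = 1`; so the
-- characteristic is 3. Since `r²` depends only on the curve, at most two such `ρ` exist.
lemma IsLinearBy.of_scaling_eq_one (h2 : (2 : F) ≠ 0) {ρ : Aut W} {c : VariableChange F}
    (hc : IsLinearBy W ρ c) (hu : c.u = 1) (hρ : ρ ≠ 1) :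
    c.r ≠ 0 ∧ c.r ^ 2 = W.a₁ * W.a₃ - W.a₄ ∧ ρ (xGen W) = xGen W + ι c.r ∧
      ρ (yGen W) = yGen W + ι (c.r * W.a₁) := by
  have hx := hc.apply_xGen
  have hy := hc.apply_yGen
  have e1 := hc.a₁
  have e2 := hc.a₂
  have e3 := hc.a₃
  have e4 := hc.a₄
  have e6 := hc.a₆
  rw [hu, Units.val_one] at hx hy e1 e2 e3 e4 e6
  have hs : c.s = 0 := (mul_eq_zero.mp (by linear_combination e1)).resolve_left h2
  rw [hs] at hy e2 e4
  have hr : c.r ≠ 0 := by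
    intro hr
    have ht : c.t = 0 := by
      refine (mul_eq_zero.mp ?_).resolve_left h2
      rw [hr] at e3
      linear_combination e3
    refine hρ (AlgEquiv.ext fun f ↦ DFunLike.congr_fun (algHom_ext W (σ := ρ.toAlgHom)
      (τ := (1 : Aut W).toAlgHom) ?_ ?_) f)
    · refine hx.trans ?_
      simp [hr]
    · refine hy.trans ?_
      simp [ht]
  have h3 : (3 : F) = 0 := (mul_eq_zero.mp (by linear_combination e2)).resolve_right hr
  have ht : c.t = c.r * W.a₁ := by linear_combination c.t * h3 - e3
  rw [ht] at e4 e6 hy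
  have ha : W.a₂ = -W.a₁ ^ 2 := by
    refine mul_left_cancel₀ hr ?_
    linear_combination -e4 + (c.r * W.a₂ + c.r ^ 2) * h3
  refine ⟨hr, mul_left_cancel₀ hr ?_, ?_, ?_⟩
  · rw [ha] at e6
    linear_combination e6 + c.r ^ 2 * W.a₁ ^ 2 * h3
  · rw [hx]
    simp
  · rw [hy]
    simp

lemma eq_or_eq_inv_of_scaling_eq_one (h2 : (2 : F) ≠ 0) {ρ σ : autO W} (hρ : scaling W ρ = 1)
    (hρ1 : ρ ≠ 1) (hσ : scaling W σ = 1) (hσ1 : σ ≠ 1) : σ = ρ ∨ σ = ρ⁻¹ := by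
  obtain ⟨c, hc⟩ := exists_isLinearBy W ρ.2
  obtain ⟨d, hd⟩ := exists_isLinearBy W σ.2
  rw [hc.scaling_eq, Units.val_eq_one] at hρ
  rw [hd.scaling_eq, Units.val_eq_one] at hσ
  obtain ⟨-, h1, hx, hy⟩ := hc.of_scaling_eq_one h2 hρ (by simpa using hρ1)
  obtain ⟨-, h1', hx', hy'⟩ := hd.of_scaling_eq_one h2 hσ (by simpa using hσ1)
  rcases sq_eq_sq_iff_eq_or_eq_neg.mp (h1'.trans h1.symm) with hr | hr
  · left
    rw [hr] at hx' hy'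
    exact Subtype.ext (AlgEquiv.ext fun f ↦ DFunLike.congr_fun (algHom_ext W
      (σ := (σ : Aut W).toAlgHom) (τ := (ρ : Aut W).toAlgHom) (hx'.trans hx.symm)
      (hy'.trans hy.symm)) f)
  · right
    rw [eq_inv_iff_mul_eq_one]
    refine Subtype.ext (AlgEquiv.ext fun f ↦ DFunLike.congr_fun (algHom_ext W
      (σ := (σ * ρ : Aut W).toAlgHom) (τ := (1 : Aut W).toAlgHom) ?_ ?_) f)
    · change (σ : Aut W) ((ρ : Aut W) (xGen W)) = xGen W
      rw [hx, map_add, hx', AlgEquiv.commutes, hr, map_neg]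
      ring
    · change (σ : Aut W) ((ρ : Aut W) (yGen W)) = yGen W
      rw [hy, map_add, hy', AlgEquiv.commutes, hr, neg_mul, map_neg]
      ring

/-- The elements with `u = 1` are `1, ρ, ρ⁻¹`, a group of order 3 stable under conjugation. As `x ↦
x + r` with `r ≠ 0` fixes no affine point, `ρ` commutes with no nontrivial translation. -/
lemma exists_complement_of_two_ne_zero [Finite F] (h2 : (2 : F) ≠ 0)
    (hker : π.ker = translationGroup W) (hπ : ∀ ρ : autO W, π ρ = ρ) {g : Aut W} (hg : g ∈ G)
    (hg1 : π g ≠ 1) (hu : scaling W (π g) = 1) :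
    ∃ C ≤ G, C ⊓ π.ker = ⊥ ∧ ∀ h ∈ G, ∃ c ∈ C, π c = π h := by
  obtain ⟨c, hc⟩ := exists_isLinearBy W (π g).2
  have hu' := hu
  rw [hc.scaling_eq, Units.val_eq_one] at hu'
  obtain ⟨hr, -, hx, -⟩ := hc.of_scaling_eq_one h2 hu' (by simpa using hg1)
  have hsq : π g * π g ≠ 1 := by
    intro h
    rw [apply_xGen_of_mul_self_eq_one (π g).2 (congr_arg Subtype.val h)] at hx
    exact hr ((map_eq_zero_iff ι (algebraMap F (FunField W)).injective).mp (by simpa using hx))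
  have hinv : π g * π g = (π g)⁻¹ := by
    refine (eq_or_eq_inv_of_scaling_eq_one h2 hu hg1 (by rw [map_mul, hu, one_mul])
      hsq).resolve_left fun h ↦ hg1 ?_
    simpa using h
  have h3 : orderOf (π g) = 3 := by
    refine orderOf_eq_prime ?_ hg1
    rw [pow_succ, pow_two, hinv, inv_mul_cancel]
  have hpow := pow_orderOf_eq_one_of_three hker hπ h3
  have : Finite ↥(π.ker ⊓ G) := by
    rw [hker]
    exact Finite.of_injective _ (Subgroup.inclusion_injective inf_le_left)
  refine exists_complement_of_normal π (fun a ha b hb ↦ ?_) G g hg hpow (by omega)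
    (fun h hh ↦ ?_) fun n hn hfix ↦ ?_
  · rw [hker] at ha hb
    exact translationGroup_comm W ha hb
  · rcases eq_or_eq_inv_of_scaling_eq_one h2 hu hg1 (σ := π h * π g * (π h)⁻¹)
      (by rw [mul_assoc, map_mul, map_mul, hu, one_mul, ← map_mul, mul_inv_cancel, map_one])
      (by simpa [conj_eq_one_iff] using hg1) with h' | h'
    · exact ⟨1, by rw [h', pow_one]⟩
    · exact ⟨2, by rw [h', pow_two, hinv]⟩
  · have hn1 := hn.1
    rw [hker] at hn1
    refine eq_one_of_inv_mul_mul_eq hc (fun a b hab _ ↦ hr ?_) hn1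
      (inv_mul_mul_eq_of_conj_eq hker hπ hn1 hfix)
    rw [hu'] at hab
    simpa using hab

omit [W.IsElliptic] in
lemma IsLinearBy.apply_xGen_of_two_eq_zero (h2 : (2 : F) = 0) (h₁ : W.a₁ ≠ 0) {ρ : Aut W}
    {c : VariableChange F} (hc : IsLinearBy W ρ c) : ρ (xGen W) = xGen W := by
  have hu : (c.u : F) = 1 := by
    refine mul_right_cancel₀ h₁ ?_
    linear_combination -hc.a₁ + c.s * h2
  have hr : c.r = 0 := by
    have e3 := hc.a₃
    rw [hu] at e3
    refine (mul_eq_zero.mp ?_).resolve_right h₁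
    linear_combination e3 - c.t * h2
  rw [hc.apply_xGen, hu, hr]
  simp

/-- Here `π g` is negation. If `a₁ = 0` it fixes no affine rational point and is central, so the
normalizer criterion applies. If `a₁ ≠ 0`, every element of `Aut(E, O)` fixes `x`, so `π(G)` is
generated by `π g`. -/
lemma exists_complement_of_two_eq_zero [Finite F] (h2 : (2 : F) = 0)
    (hker : π.ker = translationGroup W) (hπ : ∀ ρ : autO W, π ρ = ρ) {g : Aut W} (hg : g ∈ G)
    (hg1 : π g ≠ 1) (hx : (π g : Aut W) (xGen W) = xGen W) :
    ∃ C ≤ G, C ⊓ π.ker = ⊥ ∧ ∀ h ∈ G, ∃ c ∈ C, π c = π h := by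
  have hg1' : (π g : Aut W) ≠ 1 := by simpa using hg1
  have hord : orderOf (π g) = 2 := by
    refine orderOf_eq_prime ?_ hg1
    rw [pow_two]
    exact Subtype.ext (mul_self_eq_one_of_apply_xGen hx)
  have hpow := pow_orderOf_eq_one_of_even hker hπ (by omega) (hord ▸ even_two)
  by_cases h₁ : W.a₁ = 0
  · have : Finite ↥(π.ker ⊓ G) := by
      rw [hker]
      exact Finite.of_injective _ (Subgroup.inclusion_injective inf_le_left)
    refine exists_complement_of_normal π (fun a ha b hb ↦ ?_) G g hg hpow (by omega)
      (fun h hh ↦ ⟨1, ?_⟩) fun n hn hfix ↦ ?_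
    · rw [hker] at ha hb
      exact translationGroup_comm W ha hb
    · rw [pow_one]
      refine Subtype.ext (eq_of_apply_xGen_eq ?_ (by simpa [conj_eq_one_iff] using hg1) hx hg1')
      obtain ⟨c, hc⟩ := exists_isLinearBy W (inv_mem (π h).2)
      have := AlgEquiv.apply_symm_apply (π h : Aut W) (xGen W)
      change (π h : Aut W) ((π g : Aut W) (((π h)⁻¹ : Aut W) (xGen W))) = _
      refine Eq.trans ?_ this
      congr 1
      change _ = ((π h)⁻¹ : Aut W) (xGen W)
      -- `(π h)⁻¹ x` is an affine function of `x`, hence fixed by `π g`; so the conjugate of `π g`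
      -- fixes `x` and is again negation.
      rw [hc.apply_xGen, map_add, map_mul, AlgEquiv.commutes, AlgEquiv.commutes, hx]
    · have hn1 := hn.1
      rw [hker] at hn1
      obtain ⟨c, hc⟩ := exists_isLinearBy W (π g).2
      refine eq_one_of_inv_mul_mul_eq hc (fun a b hab hab' ↦ ?_) hn1
        (inv_mul_mul_eq_of_conj_eq hker hπ hn1 hfix)
      obtain ⟨hu2, hr⟩ := linear_xGen_inj W (b := 1) (c := 0)
        (.trans (by simp) (hx.symm.trans hc.apply_xGen))
      -- Fixing `x` gives `u = 1`, `r = 0`, and then `s = 0`. A fixed affine point would force `t =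
      -- 0`, contradicting `π g ≠ 1`.
      have hu : (c.u : F) = 1 := by
        refine sub_eq_zero.mp (pow_eq_zero_iff two_ne_zero |>.mp ?_)
        linear_combination (1 - c.u) * h2 - hu2
      have hs : c.s = 0 := by
        have e2 := hc.a₂
        rw [hu, h₁, ← hr] at e2
        refine pow_eq_zero_iff two_ne_zero |>.mp ?_
        linear_combination -e2
      have ht : c.t = 0 := by
        rw [hu, hs] at hab'
        linear_combination hab'
      refine hg1' (AlgEquiv.ext fun f ↦ DFunLike.congr_fun (algHom_ext W
        (σ := (π g : Aut W).toAlgHom) (τ := (1 : Aut W).toAlgHom) hx ?_) f)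
      refine hc.apply_yGen.trans ?_
      simp [hu, hs, ht]
  · refine exists_complement_of_zpowers π G g hg (fun h hh ↦ ?_) hpow
    by_cases hh1 : π h = 1
    · exact ⟨0, by rw [hh1, zpow_zero]⟩
    · obtain ⟨c, hc⟩ := exists_isLinearBy W (π h).2
      exact ⟨1, by rw [zpow_one]; exact Subtype.ext (eq_of_apply_xGen_eq
        (hc.apply_xGen_of_two_eq_zero h2 h₁) (by simpa using hh1) hx hg1')⟩

theorem exists_complement [Finite F] (hker : π.ker = translationGroup W)
    (hπ : ∀ ρ : autO W, π ρ = ρ) (G : Subgroup (Aut W)) :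
    ∃ C ≤ G, C ⊓ π.ker = ⊥ ∧ ∀ h ∈ G, ∃ c ∈ C, π c = π h := by
  by_cases h : ∀ ρ ∈ G.map π, scaling W ρ = 1 → ρ = 1
  · exact exists_complement_of_scaling_injOn hker hπ h
  push Not at h
  obtain ⟨_, ⟨g, hg, rfl⟩, hu, hg1⟩ := h
  by_cases h2 : (2 : F) = 0
  · by_cases hx : (π g : Aut W) (xGen W) = xGen W
    · exact exists_complement_of_two_eq_zero h2 hker hπ hg hg1 hx
    -- The square of `x ↦ x + r` is `x ↦ x + 2r = x`. It is nontrivial because an involution would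
    -- already fix `x`.
    · refine exists_complement_of_two_eq_zero h2 hker hπ (mul_mem hg hg) (fun h ↦ hx ?_) ?_
      · rw [map_mul] at h
        exact apply_xGen_of_mul_self_eq_one (π g).2 (congr_arg Subtype.val h)
      · obtain ⟨c, hc⟩ := exists_isLinearBy W (π g).2
        rw [hc.scaling_eq] at hu
        rw [map_mul, Subgroup.coe_mul, hc.mul_apply_xGen hc, hu]
        have := congr_arg ι h2
        simp only [map_add, map_mul, map_one, map_ofNat, map_zero, one_pow] at this ⊢
        linear_combination ι c.r * this
  · exact exists_complement_of_two_ne_zero h2 hker hπ hg hg1 hu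

end EllipticFunctionField
end

/-! ### The semidirect product decomposition of every subgroup. -/

open EllipticFunctionField in
theorem theorem3p2 {F : Type*} [Field F] [Finite F] (W : WeierstrassCurve F) [W.IsElliptic] :
    -- the projection `π`, given by the unique decomposition `σ = τ * ρ`
    ∃ π : Aut W →* autO W,
      (∀ (σ : Aut W) (ρ : autO W), (∃ τ ∈ translationGroup W, σ = τ * ρ) ↔ ρ = π σ) ∧
      ∀ G : Subgroup (Aut W),
        -- the action of `π(G)` on `T_E ∩ G` by conjugation
        ∃ φ : G.map π →* MulAut ↥(translationGroup W ⊓ G),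
          (∀ (ρ : G.map π) (τ : ↥(translationGroup W ⊓ G)),
            ((φ ρ τ : Aut W)) = (ρ : autO W) * τ * ((ρ : autO W) : Aut W)⁻¹) ∧
          ∃ e : (↥(translationGroup W ⊓ G) ⋊[φ] G.map π) ≃* G,
            (∀ τ, ((e (SemidirectProduct.inl τ) : G) : Aut W) = τ) ∧
            ∀ a, π (e a) = a.right := by
  obtain ⟨π, hker, hπ⟩ := exists_projection W
  refine ⟨π, fun σ ρ ↦ ⟨?_, ?_⟩, fun G ↦ ?_⟩
  · rintro ⟨τ, hτ, rfl⟩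
    rw [map_mul, hπ, MonoidHom.mem_ker.mp (hker ▸ hτ), one_mul]
  · rintro rfl
    refine ⟨σ * (π σ : Aut W)⁻¹, ?_, (inv_mul_cancel_right _ _).symm⟩
    rw [← hker, MonoidHom.mem_ker, map_mul, map_inv, hπ, mul_inv_cancel]
  · exact exists_semidirectProduct (translationGroup W) (autO W)
      (fun a ha b hb ↦ translationGroup_comm W ha hb) π hker hπ G (exists_complement hker hπ G)
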